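/- **Setting.** Let $\mathcal S$ be a compact metric space with a finite Borel reference measure $ds$ (for instance a compact subset of $\mathbb R^n$ with Lebesgue measure), and let $\mathcal A\subset\mathbb R^d$ be compact. Consider a Markov decision process with state space $\mathcal S$, action set $\mathcal A$, transition density $p(s'|s,a)$ and initial density $d_0(s)$ with respect to $ds$, reward $r(s,a)$ and discount factor $\gamma\in[0,1)$. Let $\Theta\subseteq\mathbb R^m$ be open and $\alpha\in\mathbb R$. For $\theta\in\Theta$ consider the mixture policy with action density $$\pi^m_\theta(a|s)=\sum_{k=1}^N \pi^w_\theta(k|s)\,\pi^c_\theta(a|s,k),\qquad a\in\mathcal A,$$ where the weights satisfy $\pi^w_\theta(k|s)>0$ and $\sum_k\pi^w_\theta(k|s)=1$. The components $\pi^c_\theta(\cdot|s,k)\ge 0$ are reparameterized: there are a set $E\subset\mathbb R^d$, a probability density $p(\varepsilon)$ on $E$ and, for all $\theta\in\Theta$, $s$, $k$, a bijection $f_\theta(\cdot;s,k):E\to\mathcal A$ with inverse $f_\theta^{-1}(\cdot;s,k)$, such that $a=f_\theta(\varepsilon;s,k)$ with $\varepsilon\sim p$ has density $\pi^c_\theta(\cdot|s,k)$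 on $\mathcal A$. Assume that $p(s'|s,a)$, $d_0(s)$, $r(s,a)$, $f_\theta(\varepsilon;s,k)$, $f_\theta^{-1}(a;s,k)$, $\pi^w_\theta(k|s)$, $\pi^c_\theta(a|s,k)$ and $p(\varepsilon)$ are jointly continuous in the variables $s,s',a,\theta,\varepsilon$ on which they depend, and that their first partial derivatives in $a$, $\theta$ and $\varepsilon$ exist and are jointly continuous as well. (As functions of $a\in\mathcal A$ or $\varepsilon\in E$ they are understood to be restrictions of functions on $\mathbb R^d$ with these properties; the derivatives in $\theta$ are taken at points of $\Theta$.) **Notation.** For a policy density $\pi$ let $\mathcal H(\pi(\cdot|s))=-\int_{\mathcal A}\pi(a|s)\log\pi(a|s)\,da$ (with $0\log 0=0$), let $\mathbb E_\pi$ be the expectation over trajectories with $S_0\sim d_0$, $A_t\sim\pi(\cdot|S_t)$, $S_{t+1}\sim p(\cdot|S_t,A_t)$, and put $$J(\pi)=\mathbb E_\pi\Big[\sum_{t\ge0}\gamma^t\big(r(S_t,A_t)+\alpha\mathcal H(\pi(\cdot|S_t))\big)\Big],$$ $$Q_\pi(s,a)=\mathbb E_\pi\Big[\sum_{t\ge0}\gamma^t\big(r(S_t,A_t)+\alpha\gamma\mathcal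 H(\pi(\cdot|S_{t+1}))\big)\,\Big|\,S_0=s,A_0=a\Big].$$ Let $d_\pi(B)=\sum_{t\ge0}\gamma^t\,\mathbb P_\pi(S_t\in B)$ be the unnormalized discounted occupancy measure. $\mathbb E_{s\sim d_\pi,\,k\sim\pi^w_\theta(\cdot|s),\,\varepsilon\sim p}$ denotes integration against $d_\pi(ds)\,\pi^w_\theta(k|s)\,p(\varepsilon)\,d\varepsilon$. Further, $\nabla_\theta f_\theta$ is the $m\times d$ transposed Jacobian of $f_\theta$ in $\theta$, and $\nabla_a$ is the gradient within $\mathcal A$. **Theorem (Entropy-Regularized Half-Reparameterization Policy Gradient Theorem).** For every $\theta\in\Theta$, the function $\theta\mapsto J(\pi^m_\theta)$ is differentiable at $\theta$, and, with $\pi=\pi^m_\theta$, $$\begin{aligned}\nabla_\theta J(\pi^m_\theta)=\mathbb E_{s\sim d_{\pi},\,k\sim\pi^w_\theta(\cdot|s),\,\varepsilon\sim p}\Big[&\nabla_\theta\log\pi^w_\theta(k|s)\,\big(Q_{\pi}(s,f_\theta(\varepsilon;s,k))-\alpha\log\pi^m_\theta(f_\theta(\varepsilon;s,k)|s)\big)\\&+\nabla_\theta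 f_\theta(\varepsilon;s,k)\,\nabla_a\big(Q_{\pi}(s,a)-\alpha\log\pi^m_\theta(a|s)\big)\big|_{a=f_\theta(\varepsilon;s,k)}\Big].\end{aligned}$$ Here, for almost every $(s,k,\varepsilon)$, the point $a=f_\theta(\varepsilon;s,k)$ lies in $\mathcal A$, $\pi^m_\theta(a|s)>0$ and $Q_\pi(s,\cdot)-\alpha\log\pi^m_\theta(\cdot|s)$ is differentiable at $a$ within $\mathcal A$, and the random vector in brackets is integrable. -/

import Mathlib

open MeasureTheory ProbabilityTheory

/-- The Euclidean space `ℝⁿ`. -/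
abbrev Vec (n : ℕ) : Type := EuclideanSpace ℝ (Fin n)

/-- The function `v ↦ g x v` is differentiable at `v` for every `(x, v) ∈ D`, and its derivative is
continuous on `D`, jointly in `(x, v)`. -/
def HasContPartial {X V F : Type*} [TopologicalSpace X] [NormedAddCommGroup V] [NormedSpace ℝ V]
    [NormedAddCommGroup F] [NormedSpace ℝ F] (D : Set (X × V)) (g : X → V → F) : Prop :=
  (∀ z ∈ D, DifferentiableAt ℝ (g z.1) z.2) ∧
    ContinuousOn (fun z : X × V => fderiv ℝ (g z.1) z.2) D

/-- The function `g θ s v` (with `θ ∈ Θ`) and its derivatives in `θ` and in `v` are jointly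
continuous. -/
structure ContC1 {S F : Type*} [TopologicalSpace S] [NormedAddCommGroup F] [NormedSpace ℝ F]
    {m d : ℕ} (Θ : Set (Vec m)) (g : Vec m → S → Vec d → F) : Prop where
  continuousOn : ContinuousOn (fun x : Vec m × S × Vec d => g x.1 x.2.1 x.2.2) {x | x.1 ∈ Θ}
  partial_param : HasContPartial {z : (S × Vec d) × Vec m | z.2 ∈ Θ} (fun y θ => g θ y.1 y.2)
  partial_var : HasContPartial {z : (Vec m × S) × Vec d | z.1.1 ∈ Θ} (fun y v => g y.1 y.2 v)

/-- A discounted Markov decision process with a compact action set `A ⊆ ℝᵈ`. The transition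
probabilities and the initial distribution have densities with respect to a reference measure `ν`
on the state space `S`. -/
structure MDP (S : Type*) [MeasurableSpace S] (ν : Measure S) (d : ℕ) where
  /-- the action set -/
  A : Set (Vec d)
  /-- the transition density; `trans s a s'` is `p(s' | s, a)` -/
  trans : S → Vec d → S → ℝ
  /-- the initial density `d₀` -/
  init : S → ℝ
  /-- the reward function `r` -/
  reward : S → Vec d → ℝ
  /-- the discount factor `γ` -/
  discount : ℝ
  isCompact_A : IsCompact A
  trans_nonneg : ∀ s, ∀ a ∈ A, ∀ s', 0 ≤ trans s a s'
  integral_trans : ∀ s, ∀ a ∈ A, ∫ s', trans s a s' ∂ν = 1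
  init_nonneg : ∀ s, 0 ≤ init s
  integral_init : ∫ s, init s ∂ν = 1
  discount_nonneg : 0 ≤ discount
  discount_lt_one : discount < 1

namespace MDP

variable {S : Type*} [MeasurableSpace S] {ν : Measure S} {d : ℕ}

/-- Lebesgue measure on the action set. -/
noncomputable def actionVolume (M : MDP S ν d) : Measure M.A :=
  Measure.comap Subtype.val (volume : Measure (Vec d))

instance isFiniteMeasure_actionVolume (M : MDP S ν d) : IsFiniteMeasure M.actionVolume := by
  refine ⟨?_⟩
  rw [actionVolume, (MeasurableEmbedding.subtype_coe M.isCompact_A.measurableSet).comap_apply,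
    Set.image_univ, Subtype.range_coe]
  exact M.isCompact_A.measure_lt_top

/-- The initial density, the transition density and the reward, and the derivatives of the latter
two with respect to the action, are jointly continuous. -/
structure Regular [TopologicalSpace S] (M : MDP S ν d) : Prop where
  continuous_init : Continuous M.init
  continuous_reward : Continuous fun x : S × Vec d => M.reward x.1 x.2
  partial_reward : HasContPartial Set.univ M.reward
  continuous_trans : Continuous fun x : S × Vec d × S => M.trans x.1 x.2.1 x.2.2
  partial_trans : HasContPartial Set.univ fun (x : S × S) a => M.trans x.1 a x.2

/-- The transition kernel `p(s' | s, a) ν(ds')`. -/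
noncomputable def transKernel (M : MDP S ν d) [SFinite ν] : Kernel (S × M.A) S :=
  (Kernel.const (S × M.A) ν).withDensity fun x s' => ENNReal.ofReal (M.trans x.1 x.2 s')

/-- The policy with action density `π`, as the kernel `π(a | s) da` on the action set. -/
noncomputable def policyKernel (M : MDP S ν d) (π : S → Vec d → ℝ) : Kernel S M.A :=
  (Kernel.const S M.actionVolume).withDensity fun s a => ENNReal.ofReal (π s a)

/-- One step `(S_t, A_t) ↦ (S_{t+1}, A_{t+1})` of the process controlled by `π`. -/
noncomputable def stepKernel (M : MDP S ν d) [SFinite ν] (π : S → Vec d → ℝ) :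
    Kernel (S × M.A) (S × M.A) :=
  M.transKernel ⊗ₖ Kernel.prodMkLeft (S × M.A) (M.policyKernel π)

open Classical in
/-- The law of the trajectory `(S_t, A_t)_{t ≥ 0}` under the policy `π` when `(S_0, A_0)` has
distribution `μ₀`. -/
noncomputable def trajLaw (M : MDP S ν d) [SFinite ν] (π : S → Vec d → ℝ)
    (μ₀ : Measure (S × M.A)) : Measure (ℕ → S × M.A) :=
  if h : IsMarkovKernel (M.stepKernel π) then
    haveI := h
    Kernel.trajMeasure (X := fun _ => S × M.A) μ₀ fun n =>
      (M.stepKernel π).comap (fun x => x ⟨n, Finset.mem_Iic.2 le_rfl⟩) (measurable_pi_apply _)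
  else 0

/-- The law of the trajectory under `π` with `S_0 ∼ d₀` and `A_0 ∼ π(· | S_0)`. -/
noncomputable def law (M : MDP S ν d) [SFinite ν] (π : S → Vec d → ℝ) :
    Measure (ℕ → S × M.A) :=
  M.trajLaw π ((ν.withDensity fun s => ENNReal.ofReal (M.init s)) ⊗ₘ M.policyKernel π)

/-- The differential entropy of `π(· | s)`. -/
noncomputable def entropy (M : MDP S ν d) (π : S → Vec d → ℝ) (s : S) : ℝ :=
  -∫ a in M.A, π s a * Real.log (π s a)

/-- The entropy-regularized objective
`J(π) = E_π[∑ₜ γᵗ (r(S_t, A_t) + α H(π(· | S_t)))]`. -/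
noncomputable def objective (M : MDP S ν d) [SFinite ν] (α : ℝ) (π : S → Vec d → ℝ) : ℝ :=
  ∫ ω, ∑' t : ℕ, M.discount ^ t *
    (M.reward (ω t).1 (ω t).2 + α * M.entropy π (ω t).1) ∂(M.law π)

open Classical in
/-- The soft action-value function
`Q_π(s, a) = E_π[∑ₜ γᵗ (r(S_t, A_t) + α γ H(π(· | S_{t+1}))) | S_0 = s, A_0 = a]` for `a ∈ A`
(and `0` for `a ∉ A`). -/
noncomputable def softQ (M : MDP S ν d) [SFinite ν] (α : ℝ) (π : S → Vec d → ℝ)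
    (s : S) (a : Vec d) : ℝ :=
  if ha : a ∈ M.A then
    ∫ ω, ∑' t : ℕ, M.discount ^ t *
      (M.reward (ω t).1 (ω t).2 + α * M.discount * M.entropy π (ω (t + 1)).1)
      ∂(M.trajLaw π (Measure.dirac (s, ⟨a, ha⟩)))
  else 0

/-- The (unnormalized) discounted occupancy measure
`d_π(B) = ∑ₜ γᵗ P_π(S_t ∈ B)`. -/
noncomputable def occupancy (M : MDP S ν d) [SFinite ν] (π : S → Vec d → ℝ) : Measure S :=
  Measure.sum fun t : ℕ =>
    ENNReal.ofReal (M.discount ^ t) • (M.law π).map fun ω => (ω t).1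

end MDP

/-- The data of a parametrized mixture policy with `N` components on `ℝᵈ`, together with a
reparameterization of the components. -/
structure ReparamMixture (S : Type*) (m N d : ℕ) where
  /-- the parameter set -/
  Θ : Set (Vec m)
  /-- the set in which the noise takes its values -/
  E : Set (Vec d)
  /-- the noise density `p(ε)` -/
  noise : Vec d → ℝ
  /-- the weighting policy `π^w_θ(k | s)` -/
  weight : Vec m → S → Fin N → ℝ
  /-- the component policies `π^c_θ(a | s, k)` -/
  comp : Vec m → S → Fin N → Vec d → ℝ
  /-- the reparameterization `f_θ(ε; s, k)` -/
  f : Vec m → S → Fin N → Vec d → Vec d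
  /-- the inverse `f_θ⁻¹(a; s, k)` -/
  finv : Vec m → S → Fin N → Vec d → Vec d

namespace ReparamMixture

variable {S : Type*} {m N d : ℕ}

/-- The density of the mixture policy, `π^m_θ(a | s) = ∑ₖ π^w_θ(k | s) π^c_θ(a | s, k)`. -/
def mixture (P : ReparamMixture S m N d) (θ : Vec m) (s : S) (a : Vec d) : ℝ :=
  ∑ k, P.weight θ s k * P.comp θ s k a

/-- The distribution `p(ε) dε` of the noise on `E`. -/
noncomputable def noiseLaw (P : ReparamMixture S m N d) : Measure (Vec d) :=
  (volume.restrict P.E).withDensity fun ε => ENNReal.ofReal (P.noise ε)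

/-- The weighting policy as a kernel from states to component indices. -/
noncomputable def weightKernel [MeasurableSpace S] (P : ReparamMixture S m N d) (θ : Vec m) :
    Kernel S (Fin N) :=
  (Kernel.const S Measure.count).withDensity fun s k => ENNReal.ofReal (P.weight θ s k)

/-- The data `P` describe a mixture policy on the action set `A`: the parameters range over an open
set, the noise and the weights are probability distributions, all weights are positive, and for each
`θ`, `s`, `k` the map `f_θ(·; s, k)` is a bijection from `E` to `A`, with inverse `f_θ⁻¹(·; s, k)`,
such that `f_θ(ε; s, k)` with `ε ∼ p` has density `π^c_θ(· | s, k)` on `A`. -/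
structure IsPolicyOn (P : ReparamMixture S m N d) (A : Set (Vec d)) : Prop where
  isOpen_Θ : IsOpen P.Θ
  noise_nonneg : ∀ ε ∈ P.E, 0 ≤ P.noise ε
  integral_noise : ∫ ε in P.E, P.noise ε = 1
  weight_pos : ∀ θ ∈ P.Θ, ∀ s k, 0 < P.weight θ s k
  sum_weight : ∀ θ ∈ P.Θ, ∀ s, ∑ k, P.weight θ s k = 1
  comp_nonneg : ∀ θ ∈ P.Θ, ∀ s k, ∀ a ∈ A, 0 ≤ P.comp θ s k a
  mapsTo : ∀ θ ∈ P.Θ, ∀ s k, Set.MapsTo (P.f θ s k) P.E A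
  mapsTo_inv : ∀ θ ∈ P.Θ, ∀ s k, Set.MapsTo (P.finv θ s k) A P.E
  invOn : ∀ θ ∈ P.Θ, ∀ s k, Set.InvOn (P.finv θ s k) (P.f θ s k) P.E A
  map_noise : ∀ θ ∈ P.Θ, ∀ s k, P.noiseLaw.map (P.f θ s k) =
    (volume.restrict A).withDensity fun a => ENNReal.ofReal (P.comp θ s k a)

/-- The functions in `P` and their derivatives with respect to `θ`, `a` and `ε` are jointly
continuous. -/
structure Regular [TopologicalSpace S] (P : ReparamMixture S m N d) : Prop where
  contDiff_noise : ContDiff ℝ 1 P.noise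
  continuousOn_weight : ∀ k,
    ContinuousOn (fun x : Vec m × S => P.weight x.1 x.2 k) {x | x.1 ∈ P.Θ}
  partial_weight : ∀ k,
    HasContPartial {z : S × Vec m | z.2 ∈ P.Θ} fun s θ => P.weight θ s k
  comp : ∀ k, ContC1 P.Θ fun θ s a => P.comp θ s k a
  f : ∀ k, ContC1 P.Θ fun θ s ε => P.f θ s k ε
  finv : ∀ k, ContC1 P.Θ fun θ s a => P.finv θ s k a

/-- The joint "distribution" of `(s, k, ε)` with `s ∼ d_π` for `π = π^m_θ`, `k ∼ π^w_θ(· | s)` and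
`ε ∼ p` (its total mass is that of `d_π`). -/
noncomputable def sampling [MeasurableSpace S] {ν : Measure S} [SFinite ν]
    (P : ReparamMixture S m N d) (M : MDP S ν d) (θ : Vec m) : Measure (S × Fin N × Vec d) :=
  M.occupancy (P.mixture θ) ⊗ₘ (P.weightKernel θ ×ₖ Kernel.const S P.noiseLaw)

/-- The function `a ↦ Q_π(s, a) - α log π(a | s)` for `π = π^m_θ`. -/
noncomputable def regQ [MeasurableSpace S] {ν : Measure S} [SFinite ν]
    (P : ReparamMixture S m N d) (M : MDP S ν d) (α : ℝ) (θ : Vec m) (s : S) (a : Vec d) : ℝ :=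
  M.softQ α (P.mixture θ) s a - α * Real.log (P.mixture θ s a)

/-- The random vector
`∇_θ log π^w_θ(k | s) (Q_π(s, f_θ(ε; s, k)) - α log π^m_θ(f_θ(ε; s, k) | s))
  + ∇_θ f_θ(ε; s, k) ∇_a (Q_π(s, a) - α log π^m_θ(a | s))` at `a = f_θ(ε; s, k)`,
where `∇_θ f_θ` is the transposed Jacobian. -/
noncomputable def halfReparam [MeasurableSpace S] {ν : Measure S} [SFinite ν]
    (P : ReparamMixture S m N d) (M : MDP S ν d) (α : ℝ) (θ : Vec m)
    (x : S × Fin N × Vec d) : Vec m :=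
  let s := x.1
  let k := x.2.1
  let ε := x.2.2
  P.regQ M α θ s (P.f θ s k ε) • gradient (fun θ' => Real.log (P.weight θ' s k)) θ +
    ContinuousLinearMap.adjoint (fderiv ℝ (fun θ' => P.f θ' s k ε) θ)
      (gradientWithin (P.regQ M α θ s) M.A (P.f θ s k ε))

end ReparamMixture

open Filter Topology

/-! Performance difference formula: if `L(π, π')(s)` is the expected return in the state `s` of
using `π'` for one step and `π` afterwards, then `J(π') - J(π)` is the integral of
`L(π, π') - L(π, π)` against `d_π'`. The integrand vanishes at `π' = π`, and `d_π'` has a density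
with respect to `ν` which is bounded uniformly in `π'`, so only `L(π, π')` has to be differentiated.
For `π' = π_θ'` it is `∑ₖ w_θ'(k | s) ∫ (Q(s, f_θ'(ε)) - α log π_θ'(f_θ'(ε) | s)) p(ε) dε`,
with `Q` the extension of `Q_π` by the Bellman equation to a function that is `C¹` in `a ∈ ℝᵈ`.

The logarithm has no bound, as `π_θ` may vanish. But the change of variables formula gives
`p(ε) = |det D_ε f_θ| π^c_θ(f_θ(ε))` for almost every `ε`, hence `1 / π_θ(f_θ(ε)) ≤ C / p(ε)`, and
`1 / p(ε)` is integrable with respect to `p(ε) dε` because `E` is compact. This dominates the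
derivative of the integrand, uniformly near `θ`. The score `∇_θ log π_θ` it contains has mean
zero. -/

/-! ### Bounded measurable functions -/

/-- A strongly measurable function that is bounded everywhere, so that it can be integrated against
every finite measure. -/
def BddMeasurable {X F : Type*} [MeasurableSpace X] [NormedAddCommGroup F] (h : X → F) : Prop :=
  StronglyMeasurable h ∧ ∃ C, ∀ x, ‖h x‖ ≤ C

namespace BddMeasurable

variable {X Y F : Type*} [MeasurableSpace X] [MeasurableSpace Y] [NormedAddCommGroup F]

lemma integrable {h : X → F} (hh : BddMeasurable h) (μ : Measure X) [IsFiniteMeasure μ] :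
    Integrable h μ := by
  obtain ⟨C, hC⟩ := hh.2
  exact Integrable.of_bound hh.1.aestronglyMeasurable C (ae_of_all _ hC)

lemma comp {h : X → F} (hh : BddMeasurable h) {g : Y → X} (hg : Measurable g) :
    BddMeasurable fun y => h (g y) :=
  ⟨hh.1.comp_measurable hg, hh.2.imp fun _ hC y => hC (g y)⟩

lemma add {h g : X → F} (hh : BddMeasurable h) (hg : BddMeasurable g) :
    BddMeasurable fun x => h x + g x := by
  obtain ⟨C, hC⟩ := hh.2
  obtain ⟨D, hD⟩ := hg.2
  exact ⟨hh.1.add hg.1, C + D, fun x => norm_add_le_of_le (hC x) (hD x)⟩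

lemma const_mul {h : X → ℝ} (hh : BddMeasurable h) (c : ℝ) : BddMeasurable fun x => c * h x := by
  obtain ⟨C, hC⟩ := hh.2
  refine ⟨hh.1.const_mul c, ‖c‖ * C, fun x => ?_⟩
  rw [norm_mul]
  exact mul_le_mul_of_nonneg_left (hC x) (norm_nonneg _)

variable [NormedSpace ℝ F]

lemma integral_kernel_prod {q : X × Y → F} (hq : BddMeasurable q) (κ : Kernel X Y)
    [IsMarkovKernel κ] : BddMeasurable fun x => ∫ y, q (x, y) ∂κ x := by
  obtain ⟨hm, C, hC⟩ := hq
  refine ⟨hm.integral_kernel_prod_right' (κ := κ), C, fun x => ?_⟩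
  simpa using norm_integral_le_of_norm_le_const (μ := κ x) (ae_of_all _ fun y => hC (x, y))

lemma integral_kernel {h : Y → F} (hh : BddMeasurable h) (κ : Kernel X Y) [IsMarkovKernel κ] :
    BddMeasurable fun x => ∫ y, h y ∂κ x :=
  (hh.comp measurable_snd).integral_kernel_prod κ

lemma integral_map {h : X → F} (hh : BddMeasurable h) {g : Y → X} (hg : Measurable g)
    (μ : Measure Y) : ∫ x, h x ∂μ.map g = ∫ y, h (g y) ∂μ :=
  MeasureTheory.integral_map hg.aemeasurable hh.1.aestronglyMeasurable

lemma integral_measure_comp {h : Y → F} (hh : BddMeasurable h) (κ : Kernel X Y)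
    [IsMarkovKernel κ] (μ : Measure X) [IsFiniteMeasure μ] :
    ∫ y, h y ∂(κ ∘ₘ μ) = ∫ x, ∫ y, h y ∂κ x ∂μ := by
  have h_int : Integrable h (κ ∘ₘ μ) := hh.integrable _
  rw [Measure.comp_eq_comp_const_apply] at h_int ⊢
  rw [Kernel.integral_comp h_int, Kernel.const_apply]

end BddMeasurable

/-! ### Discounted sums along a Markov chain -/

section Discounted

variable {Y : Type*} [MeasurableSpace Y] {γ C : ℝ} {f : ℕ → Y → ℝ}

lemma norm_pow_mul_le {r : ℝ} (hγ : 0 ≤ γ) (hr : ‖r‖ ≤ C) (t : ℕ) : ‖γ ^ t * r‖ ≤ γ ^ t * C := by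
  rw [norm_mul, Real.norm_of_nonneg (pow_nonneg hγ t)]
  exact mul_le_mul_of_nonneg_left hr (pow_nonneg hγ t)

lemma summable_discounted {r : ℕ → ℝ} (hγ : 0 ≤ γ) (hγ1 : γ < 1) (hr : ∀ t, ‖r t‖ ≤ C) :
    Summable fun t => γ ^ t * r t :=
  Summable.of_norm_bounded ((summable_geometric_of_lt_one hγ hγ1).mul_right C)
    fun t => norm_pow_mul_le hγ (hr t) t

lemma bddMeasurable_tsum_discounted (hγ : 0 ≤ γ) (hγ1 : γ < 1)
    (hfm : ∀ t, StronglyMeasurable (f t)) (hf : ∀ t y, ‖f t y‖ ≤ C) :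
    BddMeasurable fun y => ∑' t, γ ^ t * f t y :=
  ⟨(Measurable.tsum fun t => (hfm t).measurable.const_mul _).stronglyMeasurable,
    (1 - γ)⁻¹ * C, fun y => tsum_of_norm_bounded
      ((hasSum_geometric_of_lt_one hγ hγ1).mul_right C) fun t => norm_pow_mul_le hγ (hf t y) t⟩

lemma integral_tsum_discounted (hγ : 0 ≤ γ) (hγ1 : γ < 1)
    (hfm : ∀ t, StronglyMeasurable (f t)) (hf : ∀ t y, ‖f t y‖ ≤ C)
    (μ : Measure Y) [IsFiniteMeasure μ] :
    ∫ y, ∑' t, γ ^ t * f t y ∂μ = ∑' t, γ ^ t * ∫ y, f t y ∂μ := by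
  have h_sum := hasSum_integral_of_dominated_convergence (μ := μ)
    (F := fun t y => γ ^ t * f t y) (fun t _ => γ ^ t * C)
    (fun t => ((hfm t).const_mul _).aestronglyMeasurable)
    (fun t => ae_of_all _ fun y => norm_pow_mul_le hγ (hf t y) t)
    (ae_of_all _ fun _ => (summable_geometric_of_lt_one hγ hγ1).mul_right C)
    (integrable_const _)
    (ae_of_all _ fun y => (summable_discounted hγ hγ1 fun t => hf t y).hasSum)
  simpa only [integral_const_mul] using h_sum.tsum_eq.symm

end Discounted

section Chain

variable {X : Type*} [MeasurableSpace X]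

/-- The action of a kernel on real functions. -/
noncomputable def kernelAct (K : Kernel X X) (c : X → ℝ) (x : X) : ℝ := ∫ y, c y ∂K x

/-- The resolvent `∑ₜ γᵗ Kᵗ c` of a Markov kernel `K`: the expected discounted sum of the rewards
`c` collected by the chain with kernel `K`, as a function of its starting point. -/
noncomputable def discountedResolvent (K : Kernel X X) (γ : ℝ) (c : X → ℝ) (x : X) : ℝ :=
  ∑' t : ℕ, γ ^ t * (kernelAct K)^[t] c x

/-- The law of the homogeneous Markov chain with kernel `K` and initial distribution `μ₀`. -/
noncomputable def chainLaw (K : Kernel X X) [IsMarkovKernel K] (μ₀ : Measure X) :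
    Measure (ℕ → X) :=
  Kernel.trajMeasure (X := fun _ => X) μ₀ fun n =>
    K.comap (fun x => x ⟨n, Finset.mem_Iic.2 le_rfl⟩) (measurable_pi_apply _)

variable {K : Kernel X X} [IsMarkovKernel K] {γ : ℝ} {c : X → ℝ}

lemma BddMeasurable.kernelAct_iterate (hc : BddMeasurable c) (t : ℕ) :
    BddMeasurable ((kernelAct K)^[t] c) := by
  induction t generalizing c with
  | zero => exact hc
  | succ _ ih => exact ih (hc.integral_kernel K)

lemma norm_kernelAct_iterate_le {C : ℝ} (hC : ∀ x, ‖c x‖ ≤ C) (t : ℕ) (x : X) :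
    ‖(kernelAct K)^[t] c x‖ ≤ C := by
  induction t generalizing x with
  | zero => exact hC x
  | succ t ih =>
    rw [Function.iterate_succ_apply', kernelAct]
    simpa using norm_integral_le_of_norm_le_const (μ := K x) (ae_of_all _ ih)

lemma BddMeasurable.discountedResolvent (hc : BddMeasurable c) (hγ : 0 ≤ γ) (hγ1 : γ < 1) :
    BddMeasurable (discountedResolvent K γ c) := by
  obtain ⟨C, hC⟩ := hc.2
  exact bddMeasurable_tsum_discounted hγ hγ1 (fun t => (hc.kernelAct_iterate t).1)
    fun t y => norm_kernelAct_iterate_le hC t y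

lemma discountedResolvent_eq_add (hc : BddMeasurable c) (hγ : 0 ≤ γ) (hγ1 : γ < 1) (x : X) :
    discountedResolvent K γ c x = c x + γ * ∫ y, discountedResolvent K γ c y ∂K x := by
  obtain ⟨C, hC⟩ := hc.2
  unfold discountedResolvent
  rw [integral_tsum_discounted hγ hγ1 (fun t => (hc.kernelAct_iterate t).1)
      (fun t y => norm_kernelAct_iterate_le hC t y),
    (summable_discounted hγ hγ1 fun t => norm_kernelAct_iterate_le hC t x).tsum_eq_zero_add,
    ← tsum_mul_left]
  congr 1
  · simp
  · refine tsum_congr fun t => ?_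
    rw [Function.iterate_succ_apply', pow_succ', mul_assoc]
    rfl

variable (μ₀ : Measure X)

lemma chainLaw_map_zero : (chainLaw K μ₀).map (fun ω => ω 0) = μ₀ := by
  have h_eval : (fun ω : ℕ → X => ω 0) = (fun x : Finset.Iic 0 → X => x ⟨0, by simp⟩) ∘
      Preorder.frestrictLe (π := fun _ => X) 0 := rfl
  rw [h_eval, ← Measure.map_map (measurable_pi_apply _) (by fun_prop), chainLaw,
    Kernel.trajMeasure, Measure.map_comp _ _ (by fun_prop), Kernel.traj_map_frestrictLe,
    Kernel.partialTraj_self, Measure.id_comp, Measure.map_map (measurable_pi_apply _) (by fun_prop)]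
  exact Measure.map_id

variable [IsProbabilityMeasure μ₀]

instance isProbabilityMeasure_chainLaw : IsProbabilityMeasure (chainLaw K μ₀) := by
  unfold chainLaw; infer_instance

lemma chainLaw_map_succ (n : ℕ) :
    (chainLaw K μ₀).map (fun ω => ω (n + 1)) = K ∘ₘ (chainLaw K μ₀).map (fun ω => ω n) := by
  have h_joint := congrArg (Measure.map Prod.snd) <|
    Kernel.map_frestrictLe_trajMeasure_compProd_eq_map_trajMeasure (X := fun _ => X)
      (μ₀ := μ₀) (κ := fun n => K.comap (fun x : Finset.Iic n → X =>
        x ⟨n, Finset.mem_Iic.2 le_rfl⟩) (measurable_pi_apply _)) (a := n)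
  rw [Measure.map_map measurable_snd (by fun_prop), ← Measure.snd, Measure.snd_compProd] at h_joint
  refine h_joint.symm.trans ?_
  have h_eval : (fun ω : ℕ → X => ω n) = (fun x : Finset.Iic n → X =>
      x ⟨n, Finset.mem_Iic.2 le_rfl⟩) ∘ Preorder.frestrictLe (π := fun _ => X) n := rfl
  rw [h_eval, ← Measure.map_map (measurable_pi_apply _) (by fun_prop)]
  ext s hs
  rw [Measure.bind_apply hs (Kernel.aemeasurable _), Measure.bind_apply hs (Kernel.aemeasurable _),
    lintegral_map (K.measurable_coe hs) (measurable_pi_apply _)]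
  rfl

lemma integral_chainLaw_map (hc : BddMeasurable c) (t : ℕ) :
    ∫ x, c x ∂(chainLaw K μ₀).map (fun ω => ω t) = ∫ x, (kernelAct K)^[t] c x ∂μ₀ := by
  induction t generalizing c with
  | zero => rw [chainLaw_map_zero]; rfl
  | succ t ih =>
    rw [chainLaw_map_succ, hc.integral_measure_comp, Function.iterate_succ_apply]
    exact ih (hc.integral_kernel K)

lemma integral_tsum_chainLaw_dirac {r h : X → ℝ} (hr : BddMeasurable r) (hh : BddMeasurable h)
    (hγ : 0 ≤ γ) (hγ1 : γ < 1) (x : X) :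
    ∫ ω, ∑' t, γ ^ t * (r (ω t) + h (ω (t + 1))) ∂chainLaw K (Measure.dirac x) =
      discountedResolvent K γ (fun y => r y + ∫ z, h z ∂K y) x := by
  obtain ⟨C, hC⟩ := hr.2
  obtain ⟨D, hD⟩ := hh.2
  have hr_eval := fun t : ℕ => hr.comp (measurable_pi_apply (X := fun _ : ℕ => X) t)
  have hh_eval := fun t : ℕ => hh.comp (measurable_pi_apply (X := fun _ : ℕ => X) t)
  have hKh := hh.integral_kernel K
  rw [integral_tsum_discounted hγ hγ1 (fun t => ((hr_eval t).add (hh_eval (t + 1))).1)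
    (fun t ω => norm_add_le_of_le (hC (ω t)) (hD (ω (t + 1)))), discountedResolvent]
  refine tsum_congr fun t => congrArg (γ ^ t * ·) ?_
  calc ∫ ω, r (ω t) + h (ω (t + 1)) ∂chainLaw K (Measure.dirac x)
      = ∫ y, r y ∂(chainLaw K (Measure.dirac x)).map (fun ω => ω t) +
          ∫ y, h y ∂(chainLaw K (Measure.dirac x)).map (fun ω => ω (t + 1)) := by
        rw [integral_add ((hr_eval t).integrable _) ((hh_eval (t + 1)).integrable _),
          hr.integral_map (measurable_pi_apply t), hh.integral_map (measurable_pi_apply (t + 1))]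
    _ = ∫ y, r y + ∫ z, h z ∂K y ∂(chainLaw K (Measure.dirac x)).map (fun ω => ω t) := by
        rw [chainLaw_map_succ, hh.integral_measure_comp,
          integral_add (hr.integrable _) (hKh.integrable _)]
    _ = (kernelAct K)^[t] (fun y => r y + ∫ z, h z ∂K y) x := by
        rw [integral_chainLaw_map _ (hr.add hKh),
          integral_dirac' _ _ ((hr.add hKh).kernelAct_iterate t).1]

end Chain

/-! ### Measures and kernels with a real density -/

section Density

variable {X Y F : Type*} [MeasurableSpace X] [MeasurableSpace Y] [NormedAddCommGroup F]
  [NormedSpace ℝ F] {μ : Measure Y}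

lemma isProbabilityMeasure_withDensity_ofReal {p : Y → ℝ} (h_nonneg : 0 ≤ᵐ[μ] p)
    (h_one : ∫ y, p y ∂μ = 1) :
    IsProbabilityMeasure (μ.withDensity fun y => ENNReal.ofReal (p y)) where
  measure_univ := by
    rw [withDensity_apply _ MeasurableSet.univ, Measure.restrict_univ,
      ← ofReal_integral_eq_lintegral_ofReal (integrable_of_integral_eq_one h_one) h_nonneg, h_one,
      ENNReal.ofReal_one]

lemma integral_withDensity_ofReal {p : Y → ℝ} (hp : AEMeasurable p μ) (h_nonneg : 0 ≤ᵐ[μ] p)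
    (h : Y → F) :
    ∫ y, h y ∂μ.withDensity (fun y => ENNReal.ofReal (p y)) = ∫ y, p y • h y ∂μ := by
  rw [integral_withDensity_eq_integral_toReal_smul₀ hp.ennreal_ofReal
    (ae_of_all _ fun _ => ENNReal.ofReal_lt_top)]
  refine integral_congr_ae (h_nonneg.mono fun y hy => ?_)
  simp only [ENNReal.toReal_ofReal hy]

lemma withDensity_ofReal_le_smul {p : Y → ℝ} {C : ℝ} (hp : ∀ y, p y ≤ C) :
    μ.withDensity (fun y => ENNReal.ofReal (p y)) ≤ ENNReal.ofReal C • μ := by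
  rw [← withDensity_const]
  exact withDensity_mono (ae_of_all _ fun y => ENNReal.ofReal_le_ofReal (hp y))

variable [SFinite μ] {p : X → Y → ℝ}

lemma const_withDensity_ofReal_apply (hp : Measurable fun z : X × Y => p z.1 z.2) (x : X) :
    ((Kernel.const X μ).withDensity fun x y => ENNReal.ofReal (p x y)) x =
      μ.withDensity fun y => ENNReal.ofReal (p x y) := by
  rw [Kernel.withDensity_apply _ hp.ennreal_ofReal, Kernel.const_apply]

lemma isMarkovKernel_const_withDensity_ofReal (hp : Measurable fun z : X × Y => p z.1 z.2)
    (h_nonneg : ∀ x y, 0 ≤ p x y) (h_one : ∀ x, ∫ y, p x y ∂μ = 1) :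
    IsMarkovKernel ((Kernel.const X μ).withDensity fun x y => ENNReal.ofReal (p x y)) where
  isProbabilityMeasure x := by
    rw [const_withDensity_ofReal_apply hp]
    exact isProbabilityMeasure_withDensity_ofReal (ae_of_all _ (h_nonneg x)) (h_one x)

lemma integral_const_withDensity_ofReal (hp : Measurable fun z : X × Y => p z.1 z.2)
    (h_nonneg : ∀ x y, 0 ≤ p x y) (h : Y → F) (x : X) :
    ∫ y, h y ∂((Kernel.const X μ).withDensity fun x y => ENNReal.ofReal (p x y)) x =
      ∫ y, p x y • h y ∂μ := by
  rw [const_withDensity_ofReal_apply hp, integral_withDensity_ofReal (p := p x)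
    (hp.comp measurable_prodMk_left).aemeasurable (ae_of_all _ (h_nonneg x))]

end Density

/-! ### The controlled process -/

namespace MDP

variable {S : Type*} [MeasurableSpace S] {ν : Measure S} {d : ℕ} {M : MDP S ν d}
  {F : Type*} [NormedAddCommGroup F] [NormedSpace ℝ F]

/-- The function `π` is a measurable policy density on the action set, with bounded entropy. -/
structure IsPolicy (M : MDP S ν d) (π : S → Vec d → ℝ) : Prop where
  measurable : Measurable fun x : S × Vec d => π x.1 x.2
  nonneg : ∀ s, ∀ a ∈ M.A, 0 ≤ π s a
  integral_eq_one : ∀ s, ∫ a in M.A, π s a = 1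
  entropy : BddMeasurable (M.entropy π)

lemma integral_actionVolume (q : Vec d → F) :
    ∫ a, q a ∂M.actionVolume = ∫ a in M.A, q a :=
  integral_subtype_comap M.isCompact_A.measurableSet q

section Regular

variable [TopologicalSpace S]

lemma Regular.exists_density_le [CompactSpace S] (hM : M.Regular) :
    ∃ C, (∀ s, M.init s ≤ C) ∧ ∀ s, ∀ a ∈ M.A, ∀ s', M.trans s a s' ≤ C := by
  obtain ⟨C, hC⟩ := isCompact_univ.exists_bound_of_continuousOn hM.continuous_init.continuousOn
  obtain ⟨D, hD⟩ := (isCompact_univ.prod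
    (M.isCompact_A.prod isCompact_univ)).exists_bound_of_continuousOn
      hM.continuous_trans.continuousOn
  exact ⟨max C D, fun s => le_max_of_le_left ((le_abs_self _).trans (hC s trivial)),
    fun s a ha s' => le_max_of_le_right
      ((le_abs_self _).trans (hD (s, a, s') ⟨trivial, ha, trivial⟩))⟩

lemma Regular.bddMeasurable_reward [CompactSpace S] [OpensMeasurableSpace S] (hM : M.Regular) :
    BddMeasurable fun x : S × M.A => M.reward x.1 x.2 := by
  have : CompactSpace M.A := isCompact_iff_compactSpace.1 M.isCompact_A
  have h_cont : Continuous fun x : S × M.A => M.reward x.1 x.2 :=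
    hM.continuous_reward.comp (by fun_prop : Continuous fun x : S × M.A => (x.1, (x.2 : Vec d)))
  obtain ⟨C, hC⟩ := isCompact_univ.exists_bound_of_continuousOn h_cont.continuousOn
  exact ⟨h_cont.measurable.stronglyMeasurable, C, fun x => hC x trivial⟩

variable [SecondCountableTopology S] [OpensMeasurableSpace S]

lemma Regular.measurable_trans (hM : M.Regular) :
    Measurable fun x : (S × M.A) × S => M.trans x.1.1 x.1.2 x.2 :=
  (hM.continuous_trans.comp (by fun_prop : Continuous fun x : (S × M.A) × S =>
    (x.1.1, (x.1.2 : Vec d), x.2))).measurable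

variable [SFinite ν]

lemma Regular.isMarkovKernel_transKernel (hM : M.Regular) : IsMarkovKernel M.transKernel :=
  isMarkovKernel_const_withDensity_ofReal hM.measurable_trans
    (fun x => M.trans_nonneg x.1 x.2 x.2.2) fun x => M.integral_trans x.1 x.2 x.2.2

lemma Regular.integral_transKernel (hM : M.Regular) (h : S → F) (x : S × M.A) :
    ∫ s', h s' ∂M.transKernel x = ∫ s', M.trans x.1 x.2 s' • h s' ∂ν :=
  integral_const_withDensity_ofReal (p := fun (x : S × M.A) s' => M.trans x.1 x.2 s')
    hM.measurable_trans (fun x => M.trans_nonneg x.1 x.2 x.2.2) h x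

end Regular

variable {π π' : S → Vec d → ℝ}

namespace IsPolicy

lemma measurable_density (hπ : M.IsPolicy π) : Measurable fun x : S × M.A => π x.1 x.2 :=
  hπ.measurable.comp (by fun_prop : Measurable fun x : S × M.A => (x.1, (x.2 : Vec d)))

lemma integral_density (hπ : M.IsPolicy π) (s : S) : ∫ a, π s a ∂M.actionVolume = 1 := by
  rw [integral_actionVolume, hπ.integral_eq_one]

lemma integrable_density (hπ : M.IsPolicy π) (s : S) :
    Integrable (fun a : M.A => π s a) M.actionVolume :=
  integrable_of_integral_eq_one (hπ.integral_density s)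

lemma integral_policyKernel (hπ : M.IsPolicy π) (q : M.A → F) (s : S) :
    ∫ a, q a ∂M.policyKernel π s = ∫ a : M.A, π s a • q a ∂M.actionVolume :=
  integral_const_withDensity_ofReal (p := fun s (a : M.A) => π s a) hπ.measurable_density
    (fun s a => hπ.nonneg s a a.2) q s

lemma isMarkovKernel_policyKernel (hπ : M.IsPolicy π) : IsMarkovKernel (M.policyKernel π) :=
  isMarkovKernel_const_withDensity_ofReal (p := fun s (a : M.A) => π s a) hπ.measurable_density
    (fun s a => hπ.nonneg s a a.2) hπ.integral_density

end IsPolicy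

/-- The law of `S_t` under the policy `π`. -/
noncomputable def stateLaw [SFinite ν] (M : MDP S ν d) (π : S → Vec d → ℝ) (t : ℕ) : Measure S :=
  (M.law π).map fun ω => (ω t).1

/-- The expected value of `h` after one step from the state `s` under `π`. -/
noncomputable def stateStep [SFinite ν] (M : MDP S ν d) (π : S → Vec d → ℝ) (h : S → F) (s : S) :
    F :=
  ∫ a, ∫ s', h s' ∂M.transKernel (s, a) ∂M.policyKernel π s

instance isProbabilityMeasure_init (M : MDP S ν d) :
    IsProbabilityMeasure (ν.withDensity fun s => ENNReal.ofReal (M.init s)) :=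
  isProbabilityMeasure_withDensity_ofReal (ae_of_all _ M.init_nonneg) M.integral_init

lemma tsum_ofReal_discount (M : MDP S ν d) :
    ∑' t : ℕ, ENNReal.ofReal (M.discount ^ t) = ENNReal.ofReal (1 - M.discount)⁻¹ := by
  rw [← ENNReal.ofReal_tsum_of_nonneg (fun t => pow_nonneg M.discount_nonneg t)
    (summable_geometric_of_lt_one M.discount_nonneg M.discount_lt_one),
    tsum_geometric_of_lt_one M.discount_nonneg M.discount_lt_one]

section ControlledChain

variable [SFinite ν]

lemma stateLaw_eq_fst (t : ℕ) : M.stateLaw π t = ((M.law π).map fun ω => ω t).fst := by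
  rw [Measure.fst, Measure.map_map measurable_fst (measurable_pi_apply _)]; rfl

lemma occupancy_eq_sum : M.occupancy π =
    Measure.sum fun t : ℕ => ENNReal.ofReal (M.discount ^ t) • M.stateLaw π t := rfl

variable [IsMarkovKernel M.transKernel] [IsMarkovKernel (M.policyKernel π)]

instance isMarkovKernel_stepKernel : IsMarkovKernel (M.stepKernel π) := by
  unfold stepKernel; infer_instance

lemma trajLaw_eq_chainLaw (μ₀ : Measure (S × M.A)) :
    M.trajLaw π μ₀ = chainLaw (M.stepKernel π) μ₀ := by
  rw [trajLaw, dif_pos isMarkovKernel_stepKernel]; rfl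

lemma stepKernel_comp (μ : Measure (S × M.A)) [SFinite μ] :
    M.stepKernel π ∘ₘ μ = (M.transKernel ∘ₘ μ) ⊗ₘ M.policyKernel π := by
  ext B hB
  rw [Measure.bind_apply hB (Kernel.aemeasurable _), Measure.compProd_apply hB,
    Measure.lintegral_bind (Kernel.aemeasurable _)
      (Kernel.measurable_kernel_prodMk_left hB).aemeasurable]
  simp_rw [stepKernel, Kernel.compProd_apply hB, Kernel.prodMkLeft_apply]

lemma integral_stepKernel {h : S × M.A → ℝ} (hh : BddMeasurable h) (x : S × M.A) :
    ∫ y, h y ∂M.stepKernel π x = ∫ s, ∫ a, h (s, a) ∂M.policyKernel π s ∂M.transKernel x := by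
  have h_int := hh.integrable (M.stepKernel π x)
  unfold stepKernel at h_int ⊢
  rw [ProbabilityTheory.integral_compProd h_int]
  rfl

instance isProbabilityMeasure_law : IsProbabilityMeasure (M.law π) := by
  rw [law, trajLaw_eq_chainLaw]; infer_instance

instance isProbabilityMeasure_stateLaw (t : ℕ) : IsProbabilityMeasure (M.stateLaw π t) :=
  Measure.isProbabilityMeasure_map (Measurable.aemeasurable (by fun_prop))

lemma law_map_zero : (M.law π).map (fun ω => ω 0) =
    (ν.withDensity fun s => ENNReal.ofReal (M.init s)) ⊗ₘ M.policyKernel π := by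
  rw [law, trajLaw_eq_chainLaw, chainLaw_map_zero]

lemma law_map_succ (t : ℕ) : (M.law π).map (fun ω => ω (t + 1)) =
    (M.transKernel ∘ₘ ((M.law π).map fun ω => ω t)) ⊗ₘ M.policyKernel π := by
  rw [← stepKernel_comp, law, trajLaw_eq_chainLaw, chainLaw_map_succ]

lemma law_map_eq_compProd (t : ℕ) :
    (M.law π).map (fun ω => ω t) = M.stateLaw π t ⊗ₘ M.policyKernel π := by
  cases t with
  | zero => rw [stateLaw_eq_fst, law_map_zero, Measure.fst_compProd]
  | succ t => rw [stateLaw_eq_fst, law_map_succ, Measure.fst_compProd]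

lemma stateLaw_zero : M.stateLaw π 0 = ν.withDensity fun s => ENNReal.ofReal (M.init s) := by
  rw [stateLaw_eq_fst, law_map_zero, Measure.fst_compProd]

lemma stateLaw_succ (t : ℕ) :
    M.stateLaw π (t + 1) = M.transKernel ∘ₘ (M.stateLaw π t ⊗ₘ M.policyKernel π) := by
  rw [stateLaw_eq_fst, law_map_succ, Measure.fst_compProd, law_map_eq_compProd]

variable {h : S → F}

lemma bddMeasurable_stateStep (hh : BddMeasurable h) : BddMeasurable (M.stateStep π h) :=
  (hh.integral_kernel M.transKernel).integral_kernel_prod (M.policyKernel π)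

lemma integral_stateLaw_succ (hh : BddMeasurable h) (t : ℕ) :
    ∫ s, h s ∂M.stateLaw π (t + 1) = ∫ s, M.stateStep π h s ∂M.stateLaw π t := by
  rw [stateLaw_succ, hh.integral_measure_comp,
    Measure.integral_compProd ((hh.integral_kernel M.transKernel).integrable _)]
  rfl

/-! ### The discounted occupancy measure -/

instance isFiniteMeasure_occupancy : IsFiniteMeasure (M.occupancy π) where
  measure_univ_lt_top := by
    rw [occupancy_eq_sum, Measure.sum_apply _ MeasurableSet.univ]
    simp only [Measure.smul_apply, measure_univ, smul_eq_mul, mul_one, tsum_ofReal_discount]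
    exact ENNReal.ofReal_lt_top

lemma hasSum_integral_occupancy (hh : BddMeasurable h) :
    HasSum (fun t : ℕ => M.discount ^ t • ∫ s, h s ∂M.stateLaw π t)
      (∫ s, h s ∂M.occupancy π) := by
  have h_int := hh.integrable (M.occupancy π)
  rw [occupancy_eq_sum] at h_int ⊢
  convert hasSum_integral_measure h_int using 2 with t
  rw [integral_smul_measure, ENNReal.toReal_ofReal (pow_nonneg M.discount_nonneg t)]

lemma integral_occupancy_eq_add {h : S → ℝ} (hh : BddMeasurable h) :
    ∫ s, h s ∂M.occupancy π = ∫ s, h s ∂(ν.withDensity fun s => ENNReal.ofReal (M.init s)) +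
      M.discount * ∫ s, M.stateStep π h s ∂M.occupancy π := by
  have h_step := (hasSum_integral_occupancy (M := M) (π := π)
    (bddMeasurable_stateStep (M := M) (π := π) hh)).tsum_eq
  have h_sum := hasSum_integral_occupancy (M := M) (π := π) hh
  rw [← h_sum.tsum_eq, h_sum.summable.tsum_eq_zero_add, ← h_step, ← tsum_mul_left,
    ← stateLaw_zero (M := M) (π := π)]
  simp only [integral_stateLaw_succ hh, pow_succ', pow_zero, one_mul, smul_eq_mul, mul_assoc]

end ControlledChain

lemma Regular.exists_occupancy_le [TopologicalSpace S] [SecondCountableTopology S]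
    [OpensMeasurableSpace S] [CompactSpace S] [SFinite ν] (hM : M.Regular) :
    ∃ C : ℝ, ∀ π, M.IsPolicy π → M.occupancy π ≤ ENNReal.ofReal C • ν := by
  have := hM.isMarkovKernel_transKernel
  obtain ⟨C, h_init, h_trans⟩ := hM.exists_density_le
  have h_transKernel (x : S × M.A) : M.transKernel x ≤ ENNReal.ofReal C • ν := by
    rw [transKernel, const_withDensity_ofReal_apply hM.measurable_trans]
    exact withDensity_ofReal_le_smul (h_trans x.1 x.2 x.2.2)
  refine ⟨(1 - M.discount)⁻¹ * C, fun π hπ => Measure.le_iff.2 fun B hB => ?_⟩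
  have := hπ.isMarkovKernel_policyKernel
  have h_stateLaw (t : ℕ) : M.stateLaw π t B ≤ ENNReal.ofReal C * ν B := by
    cases t with
    | zero =>
      rw [stateLaw_zero]
      exact withDensity_ofReal_le_smul h_init B
    | succ t =>
      rw [stateLaw_succ, Measure.bind_apply hB (Kernel.aemeasurable _)]
      exact (lintegral_mono fun x => h_transKernel x B).trans_eq (by simp)
  rw [occupancy_eq_sum, Measure.sum_apply _ hB, Measure.smul_apply, smul_eq_mul,
    ENNReal.ofReal_mul (inv_nonneg.2 (sub_nonneg.2 M.discount_lt_one.le)), ← tsum_ofReal_discount,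
    mul_assoc, ← ENNReal.tsum_mul_right]
  exact ENNReal.tsum_le_tsum fun t => mul_le_mul_right (h_stateLaw t) _

end MDP

namespace MDP

variable {S : Type*} [MeasurableSpace S] {ν : Measure S} [SFinite ν] {d : ℕ} {M : MDP S ν d}
  {π π' : S → Vec d → ℝ}

/-! ### Continuity of the occupancy measure in the policy -/

section OccupancyContinuity

variable {F ι : Type*} [NormedAddCommGroup F] [NormedSpace ℝ F] {l : Filter ι}
  {ρ : ι → S → Vec d → ℝ}

lemma IsPolicy.norm_stateStep_sub_le [IsMarkovKernel M.transKernel] (hπ : M.IsPolicy π)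
    (hπ' : M.IsPolicy π') {δ D : ℝ} (h_close : ∀ s, ∀ a : M.A, ‖π' s a - π s a‖ ≤ δ) {h : S → F}
    (hh : BddMeasurable h) (hD : ∀ s, ‖h s‖ ≤ D) (s : S) :
    ‖M.stateStep π' h s - M.stateStep π h s‖ ≤ δ * D * M.actionVolume.real Set.univ := by
  have h_next := hh.integral_kernel M.transKernel
  have h_next_le (x : S × M.A) : ‖∫ s', h s' ∂M.transKernel x‖ ≤ D := by
    simpa using norm_integral_le_of_norm_le_const (μ := M.transKernel x) (ae_of_all _ hD)
  have h_int {σ : S → Vec d → ℝ} (hσ : M.IsPolicy σ) : Integrable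
      (fun a : M.A => σ s a • ∫ s', h s' ∂M.transKernel (s, a)) M.actionVolume :=
    (hσ.integrable_density s).smul_bdd D
      (h_next.1.comp_measurable measurable_prodMk_left).aestronglyMeasurable
      (ae_of_all _ fun a => h_next_le (s, a))
  rw [stateStep, stateStep, hπ'.integral_policyKernel, hπ.integral_policyKernel,
    ← integral_sub (h_int hπ') (h_int hπ)]
  refine norm_integral_le_of_norm_le_const (ae_of_all _ fun a => ?_)
  rw [← sub_smul, norm_smul]
  exact mul_le_mul (h_close s a) (h_next_le (s, a)) (norm_nonneg _)
    ((norm_nonneg _).trans (h_close s a))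

lemma IsPolicy.tendsto_integral_stateLaw [IsMarkovKernel M.transKernel] (hπ : M.IsPolicy π)
    (hρ : ∀ᶠ i in l, M.IsPolicy (ρ i))
    (h_unif : TendstoUniformly (fun i (x : S × M.A) => ρ i x.1 x.2) (fun x => π x.1 x.2) l)
    {h : S → F} (hh : BddMeasurable h) (t : ℕ) :
    Tendsto (fun i => ∫ s, h s ∂M.stateLaw (ρ i) t) l (𝓝 (∫ s, h s ∂M.stateLaw π t)) := by
  have := hπ.isMarkovKernel_policyKernel
  induction t generalizing h with
  | zero =>
    refine tendsto_const_nhds.congr' (hρ.mono fun i hi => ?_)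
    have := hi.isMarkovKernel_policyKernel
    simp only [stateLaw_zero]
  | succ t ih =>
    have h_step := bddMeasurable_stateStep (M := M) (π := π) hh
    have h_diff : Tendsto (fun i => ∫ s, M.stateStep (ρ i) h s - M.stateStep π h s
        ∂M.stateLaw (ρ i) t) l (𝓝 0) := by
      obtain ⟨D, hD⟩ := hh.2
      let V := M.actionVolume.real Set.univ
      refine Metric.tendsto_nhds.2 fun η hη => ?_
      obtain ⟨δ, hδ, hδη⟩ : ∃ δ > 0, δ * (D * V) < η := by
        have h_lim : Tendsto (fun δ : ℝ => δ * (D * V)) (𝓝[>] 0) (𝓝 0) := by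
          simpa using ((continuous_mul_const (D * V)).tendsto 0).mono_left nhdsWithin_le_nhds
        obtain ⟨δ, hδη, hδ⟩ :=
          ((h_lim.eventually (gt_mem_nhds hη)).and self_mem_nhdsWithin).exists
        exact ⟨δ, hδ, hδη⟩
      filter_upwards [hρ, Metric.tendstoUniformly_iff.1 h_unif δ hδ] with i hi h_close
      have := hi.isMarkovKernel_policyKernel
      have h_le := norm_integral_le_of_norm_le_const (μ := M.stateLaw (ρ i) t) (ae_of_all _
        (hπ.norm_stateStep_sub_le hi (fun s a => (dist_eq_norm' _ _).symm.trans_le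
          (h_close (s, a)).le) hh hD))
      rw [probReal_univ (μ := M.stateLaw (ρ i) t), mul_one, mul_assoc] at h_le
      rw [dist_zero_right]
      exact h_le.trans_lt hδη
    have h_sum := h_diff.add (ih h_step)
    rw [zero_add, ← integral_stateLaw_succ hh] at h_sum
    refine h_sum.congr' (hρ.mono fun i hi => ?_)
    have := hi.isMarkovKernel_policyKernel
    rw [integral_sub ((bddMeasurable_stateStep hh).integrable _) (h_step.integrable _),
      sub_add_cancel]
    exact (integral_stateLaw_succ hh t).symm

lemma IsPolicy.tendsto_integral_occupancy [CompleteSpace F] [IsMarkovKernel M.transKernel]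
    (hπ : M.IsPolicy π) (hρ : ∀ᶠ i in l, M.IsPolicy (ρ i))
    (h_unif : TendstoUniformly (fun i (x : S × M.A) => ρ i x.1 x.2) (fun x => π x.1 x.2) l)
    {h : S → F} (hh : BddMeasurable h) :
    Tendsto (fun i => ∫ s, h s ∂M.occupancy (ρ i)) l (𝓝 (∫ s, h s ∂M.occupancy π)) := by
  have := hπ.isMarkovKernel_policyKernel
  obtain ⟨D, hD⟩ := hh.2
  rw [← (hasSum_integral_occupancy hh).tsum_eq]
  have h_tsum := tendsto_tsum_of_dominated_convergence (𝓕 := l)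
    (f := fun i t => M.discount ^ t • ∫ s, h s ∂M.stateLaw (ρ i) t)
    (g := fun t => M.discount ^ t • ∫ s, h s ∂M.stateLaw π t)
    ((summable_geometric_of_lt_one M.discount_nonneg M.discount_lt_one).mul_right D)
    (fun t => (hπ.tendsto_integral_stateLaw hρ h_unif hh t).const_smul _) (hρ.mono fun i hi t => ?_)
  · refine h_tsum.congr' (hρ.mono fun i hi => ?_)
    have := hi.isMarkovKernel_policyKernel
    exact (hasSum_integral_occupancy hh).tsum_eq
  · have := hi.isMarkovKernel_policyKernel
    rw [norm_smul, Real.norm_of_nonneg (pow_nonneg M.discount_nonneg t)]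
    refine mul_le_mul_of_nonneg_left ?_ (pow_nonneg M.discount_nonneg t)
    simpa using norm_integral_le_of_norm_le_const (μ := M.stateLaw (ρ i) t) (ae_of_all _ hD)

end OccupancyContinuity

/-! ### Soft value functions and the performance difference formula -/

/-- The one-step soft reward `r(s, a) + α γ E[H(π(· | S₁)) | S₀ = s, A₀ = a]`. -/
noncomputable def softReward (M : MDP S ν d) (α : ℝ) (π : S → Vec d → ℝ) (x : S × M.A) : ℝ :=
  M.reward x.1 x.2 + α * M.discount * ∫ s', M.entropy π s' ∂M.transKernel x

/-- The soft action-value function on the state-action pairs, written as a resolvent. -/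
noncomputable def actionValue (M : MDP S ν d) (α : ℝ) (π : S → Vec d → ℝ) : S × M.A → ℝ :=
  discountedResolvent (M.stepKernel π) M.discount (M.softReward α π)

/-- The soft state-value function. -/
noncomputable def stateValue (M : MDP S ν d) (α : ℝ) (π : S → Vec d → ℝ) (s : S) : ℝ :=
  ∫ a, M.actionValue α π (s, a) ∂M.policyKernel π s + α * M.entropy π s

/-- The right-hand side of the Bellman equation for the soft action-value function. It makes sense
for every `a : ℝᵈ`, and so provides a differentiable extension of `softQ` off the action set. -/
noncomputable def bellmanQ (M : MDP S ν d) (α : ℝ) (π : S → Vec d → ℝ) (s : S) (a : Vec d) : ℝ :=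
  M.reward s a + M.discount * ∫ y, M.trans s a y • M.stateValue α π y ∂ν

/-- The soft value at `s` of acting once according to `π'` and following `π` afterwards. -/
noncomputable def lookahead (M : MDP S ν d) (α : ℝ) (π π' : S → Vec d → ℝ) (s : S) : ℝ :=
  ∫ a : M.A, M.bellmanQ α π s a ∂M.policyKernel π' s + α * M.entropy π' s

variable [TopologicalSpace S] [SecondCountableTopology S] [CompactSpace S]
  [OpensMeasurableSpace S]

namespace IsPolicy

lemma objective_eq_integral_occupancy (hM : M.Regular) (hπ : M.IsPolicy π) (α : ℝ) :
    M.objective α π =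
      ∫ s, (∫ a, M.reward s a ∂M.policyKernel π s) + α * M.entropy π s ∂M.occupancy π := by
  have := hM.isMarkovKernel_transKernel
  have := hπ.isMarkovKernel_policyKernel
  have h_cost : BddMeasurable fun x : S × M.A => M.reward x.1 x.2 + α * M.entropy π x.1 :=
    hM.bddMeasurable_reward.add ((hπ.entropy.comp measurable_fst).const_mul α)
  obtain ⟨C, hC⟩ := h_cost.2
  rw [objective, integral_tsum_discounted M.discount_nonneg M.discount_lt_one
      (f := fun t (ω : ℕ → S × M.A) => M.reward (ω t).1 (ω t).2 + α * M.entropy π (ω t).1)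
      (fun t => (h_cost.comp (measurable_pi_apply t)).1) (fun t ω => hC (ω t)),
    ← (hasSum_integral_occupancy ((hM.bddMeasurable_reward.integral_kernel_prod
      (M.policyKernel π)).add (hπ.entropy.const_mul α))).tsum_eq]
  refine tsum_congr fun t => congrArg (M.discount ^ t * ·) ?_
  refine (h_cost.integral_map (measurable_pi_apply t) _).symm.trans ?_
  rw [law_map_eq_compProd, Measure.integral_compProd (h_cost.integrable _)]
  congr 1 with s
  have h_reward : BddMeasurable fun a : M.A => M.reward s a :=
    hM.bddMeasurable_reward.comp measurable_prodMk_left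
  refine (integral_add (h_reward.integrable (M.policyKernel π s))
    (integrable_const (α * M.entropy π s))).trans ?_
  simp

variable (hM : M.Regular) (hπ : M.IsPolicy π) (α : ℝ)

include hM hπ

lemma bddMeasurable_softReward : BddMeasurable (M.softReward α π) := by
  have := hM.isMarkovKernel_transKernel
  exact hM.bddMeasurable_reward.add ((hπ.entropy.integral_kernel M.transKernel).const_mul _)

lemma bddMeasurable_actionValue : BddMeasurable (M.actionValue α π) := by
  have := hM.isMarkovKernel_transKernel
  have := hπ.isMarkovKernel_policyKernel
  exact (hπ.bddMeasurable_softReward hM α).discountedResolvent M.discount_nonneg M.discount_lt_one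

lemma bddMeasurable_integral_actionValue :
    BddMeasurable fun s => ∫ a, M.actionValue α π (s, a) ∂M.policyKernel π s := by
  have := hπ.isMarkovKernel_policyKernel
  exact (hπ.bddMeasurable_actionValue hM α).integral_kernel_prod (M.policyKernel π)

lemma bddMeasurable_stateValue : BddMeasurable (M.stateValue α π) :=
  (hπ.bddMeasurable_integral_actionValue hM α).add (hπ.entropy.const_mul α)

lemma actionValue_eq_bellmanQ (x : S × M.A) : M.actionValue α π x = M.bellmanQ α π x.1 x.2 := by
  have := hM.isMarkovKernel_transKernel
  have := hπ.isMarkovKernel_policyKernel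
  have h_resolvent : M.actionValue α π x = M.softReward α π x +
      M.discount * ∫ y, M.actionValue α π y ∂M.stepKernel π x :=
    discountedResolvent_eq_add (hπ.bddMeasurable_softReward hM α) M.discount_nonneg
      M.discount_lt_one x
  rw [h_resolvent, integral_stepKernel (hπ.bddMeasurable_actionValue hM α), bellmanQ,
    ← hM.integral_transKernel, softReward]
  unfold stateValue
  rw [integral_add ((hπ.bddMeasurable_integral_actionValue hM α).integrable _)
    ((hπ.entropy.const_mul α).integrable _), integral_const_mul]
  ring

lemma bddMeasurable_bellmanQ : BddMeasurable fun x : S × M.A => M.bellmanQ α π x.1 x.2 :=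
  funext (hπ.actionValue_eq_bellmanQ hM α) ▸ hπ.bddMeasurable_actionValue hM α

lemma softQ_eq_bellmanQ (s : S) {a : Vec d} (ha : a ∈ M.A) :
    M.softQ α π s a = M.bellmanQ α π s a := by
  have := hM.isMarkovKernel_transKernel
  have := hπ.isMarkovKernel_policyKernel
  have h_entropy : BddMeasurable fun x : S × M.A => α * M.discount * M.entropy π x.1 :=
    (hπ.entropy.comp measurable_fst).const_mul _
  rw [← hπ.actionValue_eq_bellmanQ hM α (s, ⟨a, ha⟩), softQ, dif_pos ha, trajLaw_eq_chainLaw]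
  refine (integral_tsum_chainLaw_dirac hM.bddMeasurable_reward h_entropy M.discount_nonneg
    M.discount_lt_one _).trans ?_
  rw [actionValue]
  congr 1 with x
  rw [softReward, integral_stepKernel h_entropy]
  simp [integral_const_mul]

lemma lookahead_self (s : S) : M.lookahead α π π s = M.stateValue α π s := by
  simp only [lookahead, stateValue, hπ.actionValue_eq_bellmanQ hM α]

lemma bddMeasurable_lookahead (hπ' : M.IsPolicy π') : BddMeasurable (M.lookahead α π π') := by
  have := hπ'.isMarkovKernel_policyKernel
  exact ((hπ.bddMeasurable_bellmanQ hM α).integral_kernel_prod (M.policyKernel π')).add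
    (hπ'.entropy.const_mul α)

lemma lookahead_eq_add_stateStep (hπ' : M.IsPolicy π') (s : S) :
    M.lookahead α π π' s = (∫ a, M.reward s a ∂M.policyKernel π' s) + α * M.entropy π' s +
      M.discount * M.stateStep π' (M.stateValue α π) s := by
  have := hM.isMarkovKernel_transKernel
  have := hπ'.isMarkovKernel_policyKernel
  have h_reward : BddMeasurable fun a : M.A => M.reward s a :=
    hM.bddMeasurable_reward.comp measurable_prodMk_left
  have h_next : BddMeasurable fun a : M.A => ∫ s', M.stateValue α π s' ∂M.transKernel (s, a) :=
    ((hπ.bddMeasurable_stateValue hM α).integral_kernel M.transKernel).comp measurable_prodMk_left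
  simp only [lookahead, bellmanQ]
  simp_rw [← fun a : M.A => hM.integral_transKernel (M.stateValue α π) (s, a)]
  rw [integral_add (h_reward.integrable _) ((h_next.const_mul _).integrable _),
    integral_const_mul, stateStep]
  ring

lemma integral_lookahead_sub_stateValue (hπ' : M.IsPolicy π') :
    ∫ s, M.lookahead α π π' s - M.stateValue α π s ∂M.occupancy π' = M.objective α π' -
      ∫ s, M.stateValue α π s ∂(ν.withDensity fun s => ENNReal.ofReal (M.init s)) := by
  have := hM.isMarkovKernel_transKernel
  have := hπ'.isMarkovKernel_policyKernel
  have h_value := hπ.bddMeasurable_stateValue hM α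
  have h_reward := (hM.bddMeasurable_reward.integral_kernel_prod (M.policyKernel π')).add
    (hπ'.entropy.const_mul α)
  rw [integral_sub ((hπ.bddMeasurable_lookahead hM α hπ').integrable _) (h_value.integrable _),
    integral_occupancy_eq_add h_value, hπ'.objective_eq_integral_occupancy hM]
  simp_rw [hπ.lookahead_eq_add_stateStep hM α hπ']
  rw [integral_add (h_reward.integrable _)
    (((bddMeasurable_stateStep h_value).const_mul _).integrable _), integral_const_mul]
  ring

/-- The performance difference formula of Kakade and Langford, for soft value functions. -/
lemma objective_sub_eq_integral_lookahead_sub (hπ' : M.IsPolicy π') :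
    M.objective α π' - M.objective α π =
      ∫ s, M.lookahead α π π' s - M.lookahead α π π s ∂M.occupancy π' := by
  have h_self := hπ.integral_lookahead_sub_stateValue hM α hπ
  simp only [hπ.lookahead_self hM α, sub_self, integral_zero] at h_self ⊢
  rw [hπ.integral_lookahead_sub_stateValue hM α hπ']
  linarith

end IsPolicy

end MDP

/-! ### Differentiating an integral against a varying measure -/

section VaryingMeasure

variable {E F S : Type*} [NormedAddCommGroup E] [NormedSpace ℝ E] [NormedAddCommGroup F]
  [NormedSpace ℝ F] [MeasurableSpace S] {ν : Measure S} {θ : E} {g : E → S → F}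
  {G : S → E →L[ℝ] F} {bound : S → ℝ}

lemma isLittleO_integral_norm_sub_sub (hg : ∀ᶠ θ' in 𝓝 θ, Integrable (g θ') ν)
    (hG : Integrable G ν) (h_bound : Integrable bound ν)
    (h_lip : ∀ᶠ θ' in 𝓝 θ, ∀ s, ‖g θ' s - g θ s‖ ≤ bound s * ‖θ' - θ‖)
    (h_diff : ∀ s, HasFDerivAt (fun θ' => g θ' s) (G s) θ) :
    (fun θ' => ∫ s, ‖g θ' s - g θ s - G s (θ' - θ)‖ ∂ν) =o[𝓝 θ] fun θ' => θ' - θ := by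
  have h_pointwise (s : S) :
      HasFDerivAt (fun θ' => ‖g θ' s - g θ s - G s (θ' - θ)‖) (0 : E →L[ℝ] ℝ) θ := by
    simpa [hasFDerivAt_iff_isLittleO] using (h_diff s).isLittleO.norm_left
  have h_meas {θ' : E} (h : Integrable (g θ') ν) :
      AEStronglyMeasurable (fun s => ‖g θ' s - g θ s - G s (θ' - θ)‖) ν :=
    ((h.sub hg.self_of_nhds).sub (hG.apply_continuousLinearMap _)).1.norm
  have h_deriv := (hasFDerivAt_integral_of_dominated_loc_of_lip' (𝕜 := ℝ)
    (F' := fun _ => (0 : E →L[ℝ] ℝ)) (bound := fun s => bound s + ‖G s‖) (hg.and h_lip)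
    (fun θ' h => h_meas h.1) (by simp) aestronglyMeasurable_const (ae_of_all _ fun s θ' h => ?_)
    (h_bound.add hG.norm) (ae_of_all _ h_pointwise)).2
  · simpa [hasFDerivAt_iff_isLittleO] using h_deriv
  · simp only [sub_self, map_zero, norm_zero, sub_zero, norm_norm]
    calc ‖g θ' s - g θ s - G s (θ' - θ)‖
        ≤ ‖g θ' s - g θ s‖ + ‖G s (θ' - θ)‖ := norm_sub_le _ _
      _ ≤ bound s * ‖θ' - θ‖ + ‖G s‖ * ‖θ' - θ‖ := add_le_add (h.2 s) ((G s).le_opNorm _)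
      _ = (bound s + ‖G s‖) * ‖θ' - θ‖ := by ring

lemma hasFDerivAt_integral_sub_of_le_smul {μ : E → Measure S} {C : ℝ}
    (hμ : ∀ᶠ θ' in 𝓝 θ, μ θ' ≤ ENNReal.ofReal C • ν)
    (hg : ∀ᶠ θ' in 𝓝 θ, Integrable (g θ') ν) (hG : Integrable G ν) (h_bound : Integrable bound ν)
    (h_lip : ∀ᶠ θ' in 𝓝 θ, ∀ s, ‖g θ' s - g θ s‖ ≤ bound s * ‖θ' - θ‖)
    (h_diff : ∀ s, HasFDerivAt (fun θ' => g θ' s) (G s) θ)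
    (h_lim : Tendsto (fun θ' => ∫ s, G s ∂μ θ') (𝓝 θ) (𝓝 (∫ s, G s ∂μ θ))) :
    HasFDerivAt (fun θ' => ∫ s, g θ' s - g θ s ∂μ θ') (∫ s, G s ∂μ θ) θ := by
  have h_rem : (fun θ' => ∫ s, g θ' s - g θ s - G s (θ' - θ) ∂μ θ') =o[𝓝 θ] fun θ' => θ' - θ := by
    refine Asymptotics.IsBigO.trans_isLittleO (.of_bound (ENNReal.ofReal C).toReal ?_)
      (isLittleO_integral_norm_sub_sub hg hG h_bound h_lip h_diff)
    filter_upwards [hμ, hg] with θ' hμ' hg'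
    have h_int : Integrable (fun s => ‖g θ' s - g θ s - G s (θ' - θ)‖)
        (ENNReal.ofReal C • ν) := (((hg'.sub hg.self_of_nhds).sub
      (hG.apply_continuousLinearMap _)).norm).smul_measure ENNReal.ofReal_ne_top
    rw [Real.norm_of_nonneg (integral_nonneg fun s => norm_nonneg _), ← smul_eq_mul,
      ← integral_smul_measure]
    exact (norm_integral_le_integral_norm _).trans
      (integral_mono_measure hμ' (ae_of_all _ fun s => norm_nonneg _) h_int)
  have h_main : (fun θ' => ((∫ s, G s ∂μ θ') - ∫ s, G s ∂μ θ) (θ' - θ)) =o[𝓝 θ]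
      fun θ' => θ' - θ := by
    have h_zero := tendsto_iff_norm_sub_tendsto_zero.1 h_lim
    refine Asymptotics.IsBigO.trans_isLittleO (.of_norm_le fun θ' =>
      (ContinuousLinearMap.le_opNorm _ _)) ?_
    simpa using ((Asymptotics.isLittleO_one_iff ℝ).2 h_zero).mul_isBigO
      (Asymptotics.isBigO_refl (fun θ' => ‖θ' - θ‖) (𝓝 θ))
  refine .of_isLittleO ((h_rem.add h_main).congr' ?_ .rfl)
  filter_upwards [hμ, hg] with θ' hμ' hg'
  have hG' : Integrable G (μ θ') :=
    .of_measure_le_smul (ε := E →L[ℝ] F) ENNReal.ofReal_ne_top hμ' hG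
  rw [integral_sub (f := fun s => g θ' s - g θ s)
      ((hg'.sub hg.self_of_nhds).of_measure_le_smul ENNReal.ofReal_ne_top hμ')
      (hG'.apply_continuousLinearMap _), sub_apply, ContinuousLinearMap.integral_apply hG']
  simp

end VaryingMeasure

/-! ### Derivatives and densities on measurable sets -/

section HaarMeasure

variable {E : Type*} [NormedAddCommGroup E] [NormedSpace ℝ E] [FiniteDimensional ℝ E]
  [MeasurableSpace E] [BorelSpace E] (μ : Measure E) [μ.IsAddHaarMeasure] {A : Set E}

lemma ae_eq_zero_of_hasFDerivWithinAt_zero (hA : MeasurableSet A) :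
    ∀ᵐ a ∂μ.restrict A, ∀ D : E →L[ℝ] E, HasFDerivWithinAt (fun _ => (0 : E)) D A a → D = 0 := by
  have h_select (a : E) : ∃ D : E →L[ℝ] E, HasFDerivWithinAt (fun _ => (0 : E)) D A a ∧
      (D = 0 → ∀ D' : E →L[ℝ] E, HasFDerivWithinAt (fun _ => (0 : E)) D' A a → D' = 0) := by
    by_cases! h : ∃ D : E →L[ℝ] E, HasFDerivWithinAt (fun _ => (0 : E)) D A a ∧ D ≠ 0
    · obtain ⟨D, hD, hD_ne⟩ := h
      exact ⟨D, hD, fun h_eq => absurd h_eq hD_ne⟩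
    · exact ⟨0, hasFDerivWithinAt_const _ _ _, fun _ => h⟩
  choose f' hf' h_unique using h_select
  have h_approx : ApproximatesLinearOn (fun _ : E => (0 : E)) (0 : E →L[ℝ] E) A 0 :=
    fun x _ y _ => by simp
  filter_upwards [h_approx.norm_fderiv_sub_le μ hA f' fun a _ => hf' a] with a ha
  exact h_unique a (by simpa using ha)

lemma ae_eq_of_hasFDerivWithinAt {F : Type*} [NormedAddCommGroup F] [NormedSpace ℝ F]
    (hA : MeasurableSet A) : ∀ᵐ a ∂μ.restrict A, ∀ (h : E → F) (D D' : E →L[ℝ] F),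
      HasFDerivWithinAt h D A a → HasFDerivWithinAt h D' A a → D = D' := by
  filter_upwards [ae_eq_zero_of_hasFDerivWithinAt_zero μ hA] with a h_zero h D D' hD hD'
  ext v
  by_contra h_ne
  obtain ⟨ℓ, hℓ⟩ := SeparatingDual.exists_ne_zero (R := ℝ) (sub_ne_zero.2 h_ne)
  have h_smul : HasFDerivWithinAt (fun _ => (0 : E)) ((ℓ.comp (D - D')).smulRight v) A a := by
    simpa using! ((ℓ.hasFDerivAt.comp_hasFDerivWithinAt a (hD.sub hD')).smul_const v)
  have hv := congrArg (fun B : E →L[ℝ] E => B v) (h_zero _ h_smul)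
  have hv_ne : v ≠ 0 := by
    rintro rfl
    simp at hℓ
  simp [hv_ne] at hv
  simp [hv] at hℓ

lemma ae_eq_abs_det_mul_of_map_withDensity_eq {B : Set E} (hB : MeasurableSet B)
    {f : E → E} (hf : Measurable f) {f' : E → E →L[ℝ] E}
    (hf' : ∀ x ∈ B, HasFDerivWithinAt f (f' x) B x) (h_inj : Set.InjOn f B)
    (h_maps : Set.MapsTo f B A) {p c : E → ENNReal} (hp : Measurable p) (hc : Measurable c)
    (h_map : ((μ.restrict B).withDensity p).map f = (μ.restrict A).withDensity c) :
    p =ᵐ[μ.restrict B] fun x => ENNReal.ofReal |(f' x).det| * c (f x) := by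
  refine ae_eq_of_forall_setLIntegral_eq_of_sigmaFinite₀ hp.aemeasurable
    ((aemeasurable_ofReal_abs_det_fderivWithin μ hB hf').mul (hc.comp hf).aemeasurable)
    fun T hT _ => ?_
  have hTB := hT.inter hB
  have hf'_T : ∀ x ∈ T ∩ B, HasFDerivWithinAt f (f' x) (T ∩ B) x :=
    fun x hx => (hf' x hx.2).mono Set.inter_subset_right
  have h_inj_T := h_inj.mono (Set.inter_subset_right (s := T))
  have h_image : MeasurableSet (f '' (T ∩ B)) := measurable_image_of_fderivWithin hTB hf'_T h_inj_T
  have h_subset : f '' (T ∩ B) ⊆ A := (h_maps.mono_left Set.inter_subset_right).image_subset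
  have h_preimage : f ⁻¹' (f '' (T ∩ B)) ∩ B = T ∩ B :=
    h_inj.preimage_image_inter Set.inter_subset_right
  have h_eq := congrArg (fun κ => κ (f '' (T ∩ B))) h_map
  simp only [Measure.map_apply hf h_image] at h_eq
  rw [withDensity_apply _ (hf h_image), withDensity_apply _ h_image,
    Measure.restrict_restrict (hf h_image), Measure.restrict_restrict h_image, h_preimage,
    Set.inter_eq_left.2 h_subset] at h_eq
  rw [Measure.restrict_restrict hT, h_eq,
    lintegral_image_eq_lintegral_abs_det_fderiv_mul μ hTB hf'_T h_inj_T c]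

end HaarMeasure

lemma abs_log_le_add_inv {x : ℝ} (hx : 0 < x) : |Real.log x| ≤ x + x⁻¹ := by
  have h_log := Real.log_le_sub_one_of_pos hx
  have h_log_inv := Real.log_le_sub_one_of_pos (inv_pos.2 hx)
  rw [Real.log_inv] at h_log_inv
  have := inv_pos.2 hx
  exact abs_le.2 ⟨by linarith, by linarith⟩

lemma eventually_forall_norm_le_of_isCompact {X F : Type*} [TopologicalSpace X]
    [SeminormedAddCommGroup F] {T : Set X} (hT : IsCompact T) {h : X → F}
    (hh : ContinuousOn h T) : ∀ᶠ C : ℝ in atTop, ∀ x ∈ T, ‖h x‖ ≤ C := by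
  obtain ⟨C, hC⟩ := hT.exists_bound_of_continuousOn hh
  exact (eventually_ge_atTop C).mono fun K hK x hx => (hC x hx).trans hK

/-! ### Functions with continuous partial derivatives -/

namespace ContC1

variable {S F : Type*} [TopologicalSpace S] [NormedAddCommGroup F] [NormedSpace ℝ F] {m d : ℕ}
  {Θ : Set (Vec m)} {g : Vec m → S → Vec d → F}

lemma continuousOn_fderiv_param (hg : ContC1 Θ g) :
    ContinuousOn (fun x : Vec m × S × Vec d => fderiv ℝ (fun θ => g θ x.2.1 x.2.2) x.1)
      {x | x.1 ∈ Θ} :=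
  hg.partial_param.2.comp (f := fun x : Vec m × S × Vec d => ((x.2.1, x.2.2), x.1))
    (by fun_prop) fun _ hx => hx

lemma continuousOn_fderiv_var (hg : ContC1 Θ g) :
    ContinuousOn (fun x : Vec m × S × Vec d => fderiv ℝ (g x.1 x.2.1) x.2.2) {x | x.1 ∈ Θ} :=
  hg.partial_var.2.comp (f := fun x : Vec m × S × Vec d => ((x.1, x.2.1), x.2.2))
    (by fun_prop) fun _ hx => hx

lemma continuous_of_mem (hg : ContC1 Θ g) {θ : Vec m} (hθ : θ ∈ Θ) :
    Continuous fun x : S × Vec d => g θ x.1 x.2 :=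
  hg.continuousOn.comp_continuous (f := fun x : S × Vec d => (θ, x)) (by fun_prop) fun _ => hθ

lemma continuous_fderiv_param_of_mem (hg : ContC1 Θ g) {θ : Vec m} (hθ : θ ∈ Θ) :
    Continuous fun x : S × Vec d => fderiv ℝ (fun θ' => g θ' x.1 x.2) θ :=
  hg.continuousOn_fderiv_param.comp_continuous (f := fun x : S × Vec d => (θ, x)) (by fun_prop)
    fun _ => hθ

lemma continuous_fderiv_var_of_mem (hg : ContC1 Θ g) {θ : Vec m} (hθ : θ ∈ Θ) :
    Continuous fun x : S × Vec d => fderiv ℝ (g θ x.1) x.2 :=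
  hg.continuousOn_fderiv_var.comp_continuous (f := fun x : S × Vec d => (θ, x)) (by fun_prop)
    fun _ => hθ

lemma hasFDerivAt_param (hg : ContC1 Θ g) {θ : Vec m} (hθ : θ ∈ Θ) (s : S) (v : Vec d) :
    HasFDerivAt (fun θ' => g θ' s v) (fderiv ℝ (fun θ' => g θ' s v) θ) θ :=
  (hg.partial_param.1 ((s, v), θ) hθ).hasFDerivAt

lemma hasFDerivAt_var (hg : ContC1 Θ g) {θ : Vec m} (hθ : θ ∈ Θ) (s : S) (v : Vec d) :
    HasFDerivAt (g θ s) (fderiv ℝ (g θ s) v) v :=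
  (hg.partial_var.1 ((θ, s), v) hθ).hasFDerivAt

lemma hasFDerivAt_comp (hg : ContC1 Θ g) (hΘ : IsOpen Θ) {θ : Vec m} (hθ : θ ∈ Θ) (s : S)
    {u : Vec m → Vec d} {u' : Vec m →L[ℝ] Vec d} (hu : HasFDerivAt u u' θ) :
    HasFDerivAt (fun θ' => g θ' s (u θ'))
      (fderiv ℝ (fun θ' => g θ' s (u θ)) θ + (fderiv ℝ (g θ s) (u θ)).comp u') θ := by
  have h_open : IsOpen {x : Vec m × Vec d | x.1 ∈ Θ} := hΘ.preimage continuous_fst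
  have h_mem : {x : Vec m × Vec d | x.1 ∈ Θ} ∈ 𝓝 (θ, u θ) := h_open.mem_nhds hθ
  have h_strict := hasStrictFDerivAt_uncurry_coprod (𝕜 := ℝ) (u := (θ, u θ))
    (f := fun θ' v => g θ' s v) (f₁ := fun θ' v => fderiv ℝ (fun θ' => g θ' s v) θ')
    (f₂ := fun θ' v => fderiv ℝ (g θ' s) v)
    (eventually_of_mem h_mem fun x hx => hg.hasFDerivAt_param hx s x.2)
    (eventually_of_mem h_mem fun x hx => hg.hasFDerivAt_var hx s x.2)
    ((hg.continuousOn_fderiv_param.comp (f := fun x : Vec m × Vec d => (x.1, s, x.2))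
      (by fun_prop) fun _ hx => hx).continuousAt h_mem)
    ((hg.continuousOn_fderiv_var.comp (f := fun x : Vec m × Vec d => (x.1, s, x.2))
      (by fun_prop) fun _ hx => hx).continuousAt h_mem)
  refine (h_strict.hasFDerivAt.comp θ ((hasFDerivAt_id θ).prodMk hu)).congr_fderiv
    (ContinuousLinearMap.ext fun x => ?_)
  simp [Function.HasUncurry.uncurry]

end ContC1

/-! ### Mixture policies -/

namespace ReparamMixture

section Derivatives

variable {S : Type*} [TopologicalSpace S] {m N d : ℕ} {P : ReparamMixture S m N d}

namespace Regular

variable (hreg : P.Regular)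
include hreg

lemma hasFDerivAt_weight {θ : Vec m} (hθ : θ ∈ P.Θ) (s : S) (k : Fin N) :
    HasFDerivAt (fun θ' => P.weight θ' s k) (fderiv ℝ (fun θ' => P.weight θ' s k) θ) θ :=
  ((hreg.partial_weight k).1 (s, θ) hθ).hasFDerivAt

lemma continuousOn_fderiv_weight (k : Fin N) :
    ContinuousOn (fun x : Vec m × S => fderiv ℝ (fun θ' => P.weight θ' x.2 k) x.1)
      {x | x.1 ∈ P.Θ} :=
  (hreg.partial_weight k).2.comp (f := fun x : Vec m × S => (x.2, x.1)) (by fun_prop)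
    fun _ hx => hx

lemma continuous_weight {θ : Vec m} (hθ : θ ∈ P.Θ) (k : Fin N) :
    Continuous fun s => P.weight θ s k :=
  (hreg.continuousOn_weight k).comp_continuous (f := fun s => (θ, s)) (by fun_prop) fun _ => hθ

lemma continuous_fderiv_weight {θ : Vec m} (hθ : θ ∈ P.Θ) (k : Fin N) :
    Continuous fun s => fderiv ℝ (fun θ' => P.weight θ' s k) θ :=
  (hreg.continuousOn_fderiv_weight k).comp_continuous (f := fun s => (θ, s)) (by fun_prop)
    fun _ => hθ

lemma hasFDerivAt_mixture_param {θ : Vec m} (hθ : θ ∈ P.Θ) (s : S) (a : Vec d) :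
    HasFDerivAt (fun θ' => P.mixture θ' s a)
      (∑ k, (P.weight θ s k • fderiv ℝ (fun θ' => P.comp θ' s k a) θ +
        P.comp θ s k a • fderiv ℝ (fun θ' => P.weight θ' s k) θ)) θ :=
  HasFDerivAt.fun_sum fun k _ =>
    (hreg.hasFDerivAt_weight hθ s k).mul ((hreg.comp k).hasFDerivAt_param hθ s a)

lemma hasFDerivAt_mixture_var {θ : Vec m} (hθ : θ ∈ P.Θ) (s : S) (a : Vec d) :
    HasFDerivAt (P.mixture θ s) (∑ k, P.weight θ s k • fderiv ℝ (P.comp θ s k) a) a :=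
  HasFDerivAt.fun_sum fun k _ => ((hreg.comp k).hasFDerivAt_var hθ s a).const_mul _

lemma contC1_mixture : ContC1 P.Θ P.mixture := by
  have h_weight (k : Fin N) :
      ContinuousOn (fun x : Vec m × S × Vec d => P.weight x.1 x.2.1 k) {x | x.1 ∈ P.Θ} :=
    (hreg.continuousOn_weight k).comp (f := fun x : Vec m × S × Vec d => (x.1, x.2.1))
      (by fun_prop) fun _ hx => hx
  have h_fderiv_weight (k : Fin N) : ContinuousOn (fun x : Vec m × S × Vec d =>
      fderiv ℝ (fun θ' => P.weight θ' x.2.1 k) x.1) {x | x.1 ∈ P.Θ} :=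
    (hreg.continuousOn_fderiv_weight k).comp (f := fun x : Vec m × S × Vec d => (x.1, x.2.1))
      (by fun_prop) fun _ hx => hx
  have h_param := continuousOn_finsetSum Finset.univ fun k _ =>
    ((h_weight k).smul (hreg.comp k).continuousOn_fderiv_param).add
      ((hreg.comp k).continuousOn.smul (h_fderiv_weight k))
  have h_var := continuousOn_finsetSum Finset.univ fun k _ =>
    (h_weight k).smul (hreg.comp k).continuousOn_fderiv_var
  refine ⟨continuousOn_finsetSum _ fun k _ => (h_weight k).mul (hreg.comp k).continuousOn,
    ⟨fun z hz => (hreg.hasFDerivAt_mixture_param hz z.1.1 z.1.2).differentiableAt, ?_⟩,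
    ⟨fun z hz => (hreg.hasFDerivAt_mixture_var hz z.1.2 z.2).differentiableAt, ?_⟩⟩
  · exact (h_param.comp (f := fun z : (S × Vec d) × Vec m => (z.2, z.1)) (by fun_prop)
      fun _ hx => hx).congr fun z hz => (hreg.hasFDerivAt_mixture_param hz z.1.1 z.1.2).fderiv
  · exact (h_var.comp (f := fun z : (Vec m × S) × Vec d => (z.1.1, z.1.2, z.2)) (by fun_prop)
      fun _ hx => hx).congr fun z hz => (hreg.hasFDerivAt_mixture_var hz z.1.2 z.2).fderiv

lemma continuous_f {θ : Vec m} (hθ : θ ∈ P.Θ) (s : S) (k : Fin N) : Continuous (P.f θ s k) :=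
  ((hreg.f k).continuous_of_mem hθ).comp (Continuous.prodMk_right s)

lemma continuous_finv {θ : Vec m} (hθ : θ ∈ P.Θ) (s : S) (k : Fin N) :
    Continuous (P.finv θ s k) :=
  ((hreg.finv k).continuous_of_mem hθ).comp (Continuous.prodMk_right s)

lemma continuous_comp {θ : Vec m} (hθ : θ ∈ P.Θ) (s : S) (k : Fin N) :
    Continuous (P.comp θ s k) :=
  ((hreg.comp k).continuous_of_mem hθ).comp (Continuous.prodMk_right s)

lemma continuous_mixture {θ : Vec m} (hθ : θ ∈ P.Θ) (s : S) : Continuous (P.mixture θ s) :=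
  (hreg.contC1_mixture.continuous_of_mem hθ).comp (Continuous.prodMk_right s)

end Regular

end Derivatives

namespace IsPolicyOn

variable {S : Type*} {m N d : ℕ} {P : ReparamMixture S m N d} {A : Set (Vec d)}
  (hP : P.IsPolicyOn A) {θ : Vec m}
include hP

lemma mixture_nonneg (hθ : θ ∈ P.Θ) (s : S) {a : Vec d} (ha : a ∈ A) :
    0 ≤ P.mixture θ s a :=
  Finset.sum_nonneg fun k _ =>
    mul_nonneg (hP.weight_pos θ hθ s k).le (hP.comp_nonneg θ hθ s k a ha)

lemma weight_mul_comp_le_mixture (hθ : θ ∈ P.Θ) (s : S) (k : Fin N) {a : Vec d} (ha : a ∈ A) :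
    P.weight θ s k * P.comp θ s k a ≤ P.mixture θ s a :=
  Finset.single_le_sum (f := fun k => P.weight θ s k * P.comp θ s k a)
    (fun k _ => mul_nonneg (hP.weight_pos θ hθ s k).le (hP.comp_nonneg θ hθ s k a ha))
    (Finset.mem_univ k)

lemma isProbabilityMeasure_noiseLaw (hE : MeasurableSet P.E) :
    IsProbabilityMeasure P.noiseLaw :=
  isProbabilityMeasure_withDensity_ofReal (ae_restrict_of_forall_mem hE hP.noise_nonneg)
    hP.integral_noise

variable [TopologicalSpace S] (hreg : P.Regular)
include hreg

lemma isCompact_E (hA : IsCompact A) (hθ : θ ∈ P.Θ) (s : S) (k : Fin N) : IsCompact P.E := by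
  have h_bij : Set.BijOn (P.finv θ s k) A P.E :=
    (hP.invOn θ hθ s k).symm.bijOn (hP.mapsTo_inv θ hθ s k) (hP.mapsTo θ hθ s k)
  rw [← h_bij.image_eq]
  exact hA.image (hreg.continuous_finv hθ s k)

lemma withDensity_mixture (hA : MeasurableSet A) (hθ : θ ∈ P.Θ) (s : S) :
    (volume.restrict A).withDensity (fun a => ENNReal.ofReal (P.mixture θ s a)) =
      ∑ k, ENNReal.ofReal (P.weight θ s k) • P.noiseLaw.map (P.f θ s k) := by
  have h_meas (k : Fin N) : Measurable fun a => ENNReal.ofReal (P.comp θ s k a) :=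
    (hreg.continuous_comp hθ s k).measurable.ennreal_ofReal
  ext T hT
  simp only [hP.map_noise θ hθ s, Measure.finsetSum_apply, Measure.smul_apply,
    withDensity_apply _ hT, smul_eq_mul]
  simp_rw [← lintegral_const_mul _ (h_meas _)]
  rw [← lintegral_finsetSum _ fun k _ => (h_meas k).const_mul _]
  refine lintegral_congr_ae (ae_restrict_of_ae (ae_restrict_of_forall_mem hA fun a ha => ?_))
  simp only [mixture, ← ENNReal.ofReal_mul (hP.weight_pos θ hθ s _).le]
  exact ENNReal.ofReal_sum_of_nonneg fun k _ =>
    mul_nonneg (hP.weight_pos θ hθ s k).le (hP.comp_nonneg θ hθ s k a ha)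

lemma integral_mixture_smul {F : Type*} [NormedAddCommGroup F] [NormedSpace ℝ F]
    (hA : MeasurableSet A) (hθ : θ ∈ P.Θ) (s : S) {q : Vec d → F} (hq : StronglyMeasurable q)
    (h_int : ∀ k, Integrable (fun ε => q (P.f θ s k ε)) P.noiseLaw) :
    ∫ a in A, P.mixture θ s a • q a =
      ∑ k, P.weight θ s k • ∫ ε, q (P.f θ s k ε) ∂P.noiseLaw := by
  have h_f (k : Fin N) : AEMeasurable (P.f θ s k) P.noiseLaw :=
    (hreg.continuous_f hθ s k).measurable.aemeasurable
  rw [← integral_withDensity_ofReal (hreg.continuous_mixture hθ s).measurable.aemeasurable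
      (ae_restrict_of_forall_mem hA fun a ha => hP.mixture_nonneg hθ s ha),
    hP.withDensity_mixture hreg hA hθ s, integral_finsetSum_measure fun k _ =>
      ((integrable_map_measure hq.aestronglyMeasurable (h_f k)).2 (h_int k)).smul_measure
        ENNReal.ofReal_ne_top]
  refine Finset.sum_congr rfl fun k _ => ?_
  rw [integral_smul_measure, integral_map (h_f k) hq.aestronglyMeasurable,
    ENNReal.toReal_ofReal (hP.weight_pos θ hθ s k).le]

lemma integral_mixture (hA : MeasurableSet A) (hE : MeasurableSet P.E) (hθ : θ ∈ P.Θ) (s : S) :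
    ∫ a in A, P.mixture θ s a = 1 := by
  have := hP.isProbabilityMeasure_noiseLaw hE
  simpa [hP.sum_weight θ hθ s] using hP.integral_mixture_smul hreg hA hθ s (q := fun _ => (1 : ℝ))
    stronglyMeasurable_const fun _ => integrable_const _

lemma ae_noise_eq_abs_det_mul_comp (hE : MeasurableSet P.E) (hθ : θ ∈ P.Θ) (s : S) (k : Fin N) :
    ∀ᵐ ε ∂volume.restrict P.E,
      P.noise ε = |(fderiv ℝ (P.f θ s k) ε).det| * P.comp θ s k (P.f θ s k ε) := by
  have h_density := ae_eq_abs_det_mul_of_map_withDensity_eq volume hE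
    (hreg.continuous_f hθ s k).measurable
    (fun ε _ => ((hreg.f k).hasFDerivAt_var hθ s ε).hasFDerivWithinAt)
    (hP.invOn θ hθ s k).1.injOn (hP.mapsTo θ hθ s k)
    hreg.contDiff_noise.continuous.measurable.ennreal_ofReal
    (hreg.continuous_comp hθ s k).measurable.ennreal_ofReal (hP.map_noise θ hθ s k)
  filter_upwards [h_density, ae_restrict_mem hE] with ε h_eq hε
  have h_comp := hP.comp_nonneg θ hθ s k _ (hP.mapsTo θ hθ s k hε)
  rw [← ENNReal.ofReal_mul (abs_nonneg _)] at h_eq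
  exact (ENNReal.ofReal_eq_ofReal_iff (hP.noise_nonneg ε hε) (by positivity)).1 h_eq

end IsPolicyOn

/-- The noise value `ε` lies in `E`, has positive density, and satisfies the change of variables
formula `p(ε) = |det D_ε f| π^c(f(ε))` for all parameters, states and components simultaneously. -/
structure GoodNoise {S : Type*} {m N d : ℕ} (P : ReparamMixture S m N d) (ε : Vec d) : Prop where
  mem : ε ∈ P.E
  noise_pos : 0 < P.noise ε
  noise_eq : ∀ θ ∈ P.Θ, ∀ s k,
    P.noise ε = |(fderiv ℝ (P.f θ s k) ε).det| * P.comp θ s k (P.f θ s k ε)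

variable {S : Type*} {m N d : ℕ} {P : ReparamMixture S m N d} {A : Set (Vec d)}

lemma Regular.ae_noiseLaw_pos [TopologicalSpace S] (hreg : P.Regular) (hE : MeasurableSet P.E) :
    ∀ᵐ ε ∂P.noiseLaw, ε ∈ P.E ∧ 0 < P.noise ε := by
  rw [noiseLaw, ae_withDensity_iff hreg.contDiff_noise.continuous.measurable.ennreal_ofReal]
  filter_upwards [ae_restrict_mem hE] with ε hε h_ne
  exact ⟨hε, by simpa using h_ne⟩

/- The formula holds a.e. for each `(θ, s)`, hence a.e. on a countable dense set of pairs `(θ, s)`;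
both sides are continuous in `(θ, s)`. -/
lemma IsPolicyOn.ae_goodNoise [TopologicalSpace S] [SecondCountableTopology S]
    (hP : P.IsPolicyOn A) (hreg : P.Regular) (hE : MeasurableSet P.E) :
    ∀ᵐ ε ∂P.noiseLaw, P.GoodNoise ε := by
  obtain ⟨D, hD_countable, hD⟩ := TopologicalSpace.exists_countable_dense (P.Θ × S)
  have h_dense : ∀ᵐ ε ∂volume.restrict P.E, ∀ k, ∀ x ∈ D, P.noise ε =
      |(fderiv ℝ (P.f x.1 x.2 k) ε).det| * P.comp x.1 x.2 k (P.f x.1 x.2 k ε) :=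
    ae_all_iff.2 fun k => (ae_ball_iff hD_countable).2 fun x _ =>
      hP.ae_noise_eq_abs_det_mul_comp hreg hE x.1.2 x.2 k
  filter_upwards [hreg.ae_noiseLaw_pos hE, withDensity_absolutelyContinuous _ _ h_dense]
    with ε hε h_eq
  refine ⟨hε.1, hε.2, fun θ hθ s k => ?_⟩
  have h_f : Continuous fun x : P.Θ × S => P.f x.1 x.2 k ε :=
    (hreg.f k).continuousOn.comp_continuous (f := fun x : P.Θ × S => ((x.1 : Vec m), x.2, ε))
      (by fun_prop) fun x => x.1.2
  have h_comp : Continuous fun x : P.Θ × S => P.comp x.1 x.2 k (P.f x.1 x.2 k ε) :=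
    (hreg.comp k).continuousOn.comp_continuous
      (f := fun x : P.Θ × S => ((x.1 : Vec m), x.2, P.f x.1 x.2 k ε)) (by fun_prop) fun x => x.1.2
  have h_det : Continuous fun x : P.Θ × S => |(fderiv ℝ (P.f x.1 x.2 k) ε).det| :=
    (ContinuousLinearMap.continuous_det.comp
      ((hreg.f k).continuousOn_fderiv_var.comp_continuous
        (f := fun x : P.Θ × S => ((x.1 : Vec m), x.2, ε)) (by fun_prop) fun x => x.1.2)).abs
  exact congrFun (Continuous.ext_on hD continuous_const (h_det.mul h_comp) (h_eq k)) (⟨θ, hθ⟩, s)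

lemma GoodNoise.comp_pos {ε : Vec d} (hε : P.GoodNoise ε) {θ : Vec m}
    (hθ : θ ∈ P.Θ) (s : S) (k : Fin N) : 0 < P.comp θ s k (P.f θ s k ε) := by
  have h_pos := hε.noise_pos
  rw [hε.noise_eq θ hθ s k] at h_pos
  exact pos_of_mul_pos_right h_pos (abs_nonneg _)

lemma GoodNoise.mixture_pos (hP : P.IsPolicyOn A) {ε : Vec d} (hε : P.GoodNoise ε) {θ : Vec m}
    (hθ : θ ∈ P.Θ) (s : S) (k : Fin N) : 0 < P.mixture θ s (P.f θ s k ε) :=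
  (mul_pos (hP.weight_pos θ hθ s k) (hε.comp_pos hθ s k)).trans_le
    (hP.weight_mul_comp_le_mixture hθ s k (hP.mapsTo θ hθ s k hε.mem))

end ReparamMixture

/-! ### Local bounds -/

/-- A convex neighbourhood on which functions continuous on `Θ` are bounded. -/
structure IsLocalDomain {m : ℕ} (Θ U : Set (Vec m)) : Prop where
  isOpen : IsOpen U
  convex : Convex ℝ U
  isCompact_closure : IsCompact (closure U)
  closure_subset : closure U ⊆ Θ

section LocalDomain

variable {m : ℕ} {Θ U : Set (Vec m)}

lemma exists_isLocalDomain (hΘ : IsOpen Θ) {θ : Vec m} (hθ : θ ∈ Θ) :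
    ∃ U, θ ∈ U ∧ IsLocalDomain Θ U := by
  obtain ⟨r, hr, h_subset⟩ := Metric.nhds_basis_closedBall.mem_iff.1 (hΘ.mem_nhds hθ)
  exact ⟨Metric.ball θ r, Metric.mem_ball_self hr, Metric.isOpen_ball, convex_ball θ r,
    Metric.isBounded_ball.isCompact_closure, Metric.closure_ball_subset_closedBall.trans h_subset⟩

namespace IsLocalDomain

lemma subset (hU : IsLocalDomain Θ U) : U ⊆ Θ := subset_closure.trans hU.closure_subset

lemma eventually_forall_norm_le {X V F : Type*} [TopologicalSpace X] [CompactSpace X]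
    [TopologicalSpace V] [SeminormedAddCommGroup F] (hU : IsLocalDomain Θ U) {T : Set V}
    (hT : IsCompact T) {h : Vec m × X × V → F} (hh : ContinuousOn h {x | x.1 ∈ Θ}) :
    ∀ᶠ C : ℝ in atTop, ∀ θ ∈ U, ∀ x, ∀ v ∈ T, ‖h (θ, x, v)‖ ≤ C := by
  refine (eventually_forall_norm_le_of_isCompact (hU.isCompact_closure.prod
    (isCompact_univ.prod hT)) (hh.mono fun x hx => hU.closure_subset hx.1)).mono
    fun C hC θ hθ x v hv => hC (θ, x, v) ⟨subset_closure hθ, trivial, hv⟩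

end IsLocalDomain

end LocalDomain

namespace ReparamMixture

/-- A mixture policy on a compact action set whose noise takes its values in a compact set and whose
data are continuously differentiable. -/
structure IsC1PolicyOn {S : Type*} [TopologicalSpace S] {m N d : ℕ} (P : ReparamMixture S m N d)
    (A : Set (Vec d)) : Prop extends IsPolicyOn P A, Regular P where
  isCompact_A : IsCompact A
  isCompact_E : IsCompact P.E

/-- The function `b(ε) = 1 + 1 / p(ε)`. It is integrable with respect to `p(ε) dε` because `E` is
compact. -/
noncomputable def noiseBound {S : Type*} {m N d : ℕ} (P : ReparamMixture S m N d) (ε : Vec d) : ℝ :=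
  1 + (P.noise ε)⁻¹

/-- On `U`, the function `h θ s k ε` is bounded by a multiple of `b ε`, uniformly in `θ`, `s`
and `k`. -/
def NoiseDominated {S F : Type*} {m N d : ℕ} [Norm F] (P : ReparamMixture S m N d)
    (U : Set (Vec m)) (b : Vec d → ℝ) (h : Vec m → S → Fin N → Vec d → F) : Prop :=
  ∃ C, ∀ θ ∈ U, ∀ s k ε, P.GoodNoise ε → ‖h θ s k ε‖ ≤ C * b ε

section NoiseDominated

variable {S F G H : Type*} {m N d : ℕ} [SeminormedAddCommGroup F] [SeminormedAddCommGroup G]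
  [SeminormedAddCommGroup H] {P : ReparamMixture S m N d} {A : Set (Vec d)} {U : Set (Vec m)}
  {b : Vec d → ℝ} {h : Vec m → S → Fin N → Vec d → F} {g : Vec m → S → Fin N → Vec d → G}
  {q : Vec m → S → Fin N → Vec d → H}

namespace NoiseDominated

lemma of_norm_le_add (hh : P.NoiseDominated U b h) (hg : P.NoiseDominated U b g)
    (hq : ∀ θ s k ε, ‖q θ s k ε‖ ≤ ‖h θ s k ε‖ + ‖g θ s k ε‖) : P.NoiseDominated U b q := by
  obtain ⟨C, hC⟩ := hh
  obtain ⟨D, hD⟩ := hg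
  refine ⟨C + D, fun θ hθ s k ε hε => (hq θ s k ε).trans ?_⟩
  rw [add_mul]
  exact add_le_add (hC θ hθ s k ε hε) (hD θ hθ s k ε hε)

lemma of_norm_le_mul (hh : P.NoiseDominated U b h) (hg : P.NoiseDominated U 1 g)
    (hq : ∀ θ ∈ U, ∀ s k ε, P.GoodNoise ε → ‖q θ s k ε‖ ≤ ‖h θ s k ε‖ * ‖g θ s k ε‖) :
    P.NoiseDominated U b q := by
  obtain ⟨C, hC⟩ := hh
  obtain ⟨D, hD⟩ := hg
  refine ⟨C * D, fun θ hθ s k ε hε => (hq θ hθ s k ε hε).trans ?_⟩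
  have h_le := hC θ hθ s k ε hε
  calc ‖h θ s k ε‖ * ‖g θ s k ε‖ ≤ C * b ε * D := by
        refine mul_le_mul h_le ?_ (norm_nonneg _) ((norm_nonneg _).trans h_le)
        simpa using hD θ hθ s k ε hε
    _ = C * D * b ε := by ring

lemma const_smul [NormedSpace ℝ F] (hh : P.NoiseDominated U b h) (c : ℝ) :
    P.NoiseDominated U b fun θ s k ε => c • h θ s k ε :=
  hh.of_norm_le_mul (g := fun _ _ _ _ => c) ⟨‖c‖, by simp⟩ fun _ _ _ _ _ _ => by
    rw [norm_smul, mul_comm]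

end NoiseDominated

lemma GoodNoise.one_le_noiseBound {ε : Vec d} (hε : P.GoodNoise ε) : 1 ≤ P.noiseBound ε :=
  le_add_of_nonneg_right (inv_nonneg.2 hε.noise_pos.le)

lemma NoiseDominated.noiseBound (hh : P.NoiseDominated U 1 h) :
    P.NoiseDominated U P.noiseBound h := by
  obtain ⟨C, hC⟩ := hh
  refine ⟨C, fun θ hθ s k ε hε => ?_⟩
  have h_le : ‖h θ s k ε‖ ≤ C := by simpa using hC θ hθ s k ε hε
  exact h_le.trans (le_mul_of_one_le_right ((norm_nonneg _).trans h_le) hε.one_le_noiseBound)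

lemma noiseDominated_inv_noise : P.NoiseDominated U P.noiseBound fun _ _ _ ε => (P.noise ε)⁻¹ := by
  refine ⟨1, fun θ _ s k ε hε => ?_⟩
  rw [Real.norm_of_nonneg (inv_nonneg.2 hε.noise_pos.le), noiseBound]
  linarith

lemma NoiseDominated.of_continuousOn [TopologicalSpace S] [CompactSpace S]
    (hU : IsLocalDomain P.Θ U) (hE : IsCompact P.E)
    (hh : ∀ k, ContinuousOn (fun x : Vec m × S × Vec d => h x.1 x.2.1 k x.2.2) {x | x.1 ∈ P.Θ}) :
    P.NoiseDominated U 1 h := by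
  obtain ⟨C, hC⟩ := (eventually_all.2 fun k => hU.eventually_forall_norm_le hE (hh k)).exists
  exact ⟨C, fun θ hθ s k ε hε => by simpa using hC k θ hθ s ε hε.mem⟩

/- The weights are bounded below, and so is `π^c(f(ε)) = p(ε) / |det D_ε f|`, up to the factor
`p(ε)`. -/
lemma GoodNoise.norm_inv_mixture_le (hP : P.IsPolicyOn A) {ε : Vec d} (hε : P.GoodNoise ε)
    {θ : Vec m} (hθ : θ ∈ P.Θ) (s : S) (k : Fin N) :
    ‖(P.mixture θ s (P.f θ s k ε))⁻¹‖ ≤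
      ‖(P.noise ε)⁻¹‖ * ‖(P.weight θ s k)⁻¹ * (fderiv ℝ (P.f θ s k) ε).det‖ := by
  have h_weight := hP.weight_pos θ hθ s k
  have h_comp := hε.comp_pos hθ s k
  have h_det : 0 < |(fderiv ℝ (P.f θ s k) ε).det| :=
    pos_of_mul_pos_left (hε.noise_eq θ hθ s k ▸ hε.noise_pos) h_comp.le
  rw [norm_mul, norm_inv, norm_inv, norm_inv, Real.norm_of_nonneg hε.noise_pos.le,
    Real.norm_of_nonneg h_weight.le, Real.norm_of_nonneg (hε.mixture_pos hP hθ s k).le,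
    Real.norm_eq_abs]
  calc (P.mixture θ s (P.f θ s k ε))⁻¹ ≤ (P.weight θ s k * P.comp θ s k (P.f θ s k ε))⁻¹ :=
        inv_anti₀ (mul_pos h_weight h_comp)
          (hP.weight_mul_comp_le_mixture hθ s k (hP.mapsTo θ hθ s k hε.mem))
    _ = (P.noise ε)⁻¹ * ((P.weight θ s k)⁻¹ * |(fderiv ℝ (P.f θ s k) ε).det|) := by
        rw [hε.noise_eq θ hθ s k]
        field_simp

end NoiseDominated

section Integrability

variable {S : Type*} [TopologicalSpace S] {m N d : ℕ} {P : ReparamMixture S m N d}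
  {A : Set (Vec d)} {U : Set (Vec m)} {F : Type*} [NormedAddCommGroup F]

lemma Regular.integrable_noiseBound (hreg : P.Regular) (hE : IsCompact P.E) :
    Integrable P.noiseBound P.noiseLaw := by
  have h_cont := hreg.contDiff_noise.continuous
  have h_int : IntegrableOn (fun ε => ‖P.noise ε‖ + 1) P.E :=
    (h_cont.norm.add continuous_const).continuousOn.integrableOn_compact hE
  rw [noiseLaw, integrable_withDensity_iff_integrable_smul' h_cont.measurable.ennreal_ofReal
    (ae_of_all _ fun _ => ENNReal.ofReal_lt_top)]
  refine h_int.mono' (h_cont.measurable.ennreal_ofReal.ennreal_toReal.smul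
    (h_cont.measurable.inv.const_add 1)).aestronglyMeasurable (ae_of_all _ fun ε => ?_)
  rcases le_or_gt (P.noise ε) 0 with h_nonpos | h_pos
  · simp only [ENNReal.ofReal_eq_zero.2 h_nonpos, ENNReal.toReal_zero, zero_smul, norm_zero]
    positivity
  · rw [ENNReal.toReal_ofReal h_pos.le, noiseBound, smul_eq_mul, mul_add, mul_one,
      mul_inv_cancel₀ h_pos.ne', Real.norm_of_nonneg h_pos.le]
    exact (Real.norm_of_nonneg (by positivity)).le

variable [SecondCountableTopology S] (hP : P.IsC1PolicyOn A)
include hP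

lemma NoiseDominated.integrable {h : Vec m → S → Fin N → Vec d → F}
    (hh : P.NoiseDominated U P.noiseBound h) {θ : Vec m} (hθ : θ ∈ U) (s : S) (k : Fin N)
    (h_meas : AEStronglyMeasurable (h θ s k) P.noiseLaw) :
    Integrable (h θ s k) P.noiseLaw := by
  obtain ⟨C, hC⟩ := hh
  refine ((hP.integrable_noiseBound hP.isCompact_E).const_mul C).mono' h_meas ?_
  filter_upwards [hP.ae_goodNoise hP.toRegular hP.isCompact_E.measurableSet] with ε hε
    using hC θ hθ s k ε hε

lemma NoiseDominated.exists_norm_integral_le [NormedSpace ℝ F] {h : Vec m → S → Fin N → Vec d → F}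
    (hh : P.NoiseDominated U P.noiseBound h) :
    ∃ C, ∀ θ ∈ U, ∀ s k, ‖∫ ε, h θ s k ε ∂P.noiseLaw‖ ≤ C := by
  obtain ⟨C, hC⟩ := hh
  refine ⟨∫ ε, C * P.noiseBound ε ∂P.noiseLaw, fun θ hθ s k => norm_integral_le_of_norm_le
    ((hP.integrable_noiseBound hP.isCompact_E).const_mul C) ?_⟩
  filter_upwards [hP.ae_goodNoise hP.toRegular hP.isCompact_E.measurableSet] with ε hε
    using hC θ hθ s k ε hε

lemma NoiseDominated.hasFDerivAt_integral {h : Vec m → S → Fin N → Vec d → ℝ}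
    {h' : Vec m → S → Fin N → Vec d → Vec m →L[ℝ] ℝ} (hh' : P.NoiseDominated U P.noiseBound h')
    (hU : IsOpen U) (s : S) (k : Fin N) (h_int : ∀ θ ∈ U, Integrable (h θ s k) P.noiseLaw)
    {θ : Vec m} (hθ : θ ∈ U) (h_meas : AEStronglyMeasurable (h' θ s k) P.noiseLaw)
    (h_diff : ∀ θ ∈ U, ∀ ε, P.GoodNoise ε →
      HasFDerivAt (fun θ' => h θ' s k ε) (h' θ s k ε) θ) :
    HasFDerivAt (fun θ' => ∫ ε, h θ' s k ε ∂P.noiseLaw) (∫ ε, h' θ s k ε ∂P.noiseLaw) θ := by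
  obtain ⟨C, hC⟩ := hh'
  have h_good := hP.ae_goodNoise hP.toRegular hP.isCompact_E.measurableSet
  refine hasFDerivAt_integral_of_dominated_of_fderiv_le (hU.mem_nhds hθ)
    (bound := fun ε => C * P.noiseBound ε) (F' := fun θ => h' θ s k)
    (eventually_of_mem (hU.mem_nhds hθ) fun θ' hθ' => (h_int θ' hθ').aestronglyMeasurable)
    (h_int θ hθ) h_meas ?_ ((hP.integrable_noiseBound hP.isCompact_E).const_mul C) ?_
  · filter_upwards [h_good] with ε hε θ' hθ' using hC θ' hθ' s k ε hε
  · filter_upwards [h_good] with ε hε θ' hθ' using h_diff θ' hθ' ε hε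

end Integrability

/-! ### The regularized action value along the reparameterization -/

section Definitions

variable {S : Type*} {m N d : ℕ}

/-- The regularized action value `B(s, a) - α log π_θ(a | s)`. -/
noncomputable def regularize (P : ReparamMixture S m N d) (B : S → Vec d → ℝ) (α : ℝ) (θ : Vec m)
    (s : S) (a : Vec d) : ℝ :=
  B s a - α * Real.log (P.mixture θ s a)

/-- The derivative of `regularize` in the action. -/
noncomputable def regularizeDeriv (P : ReparamMixture S m N d) (B : S → Vec d → ℝ) (α : ℝ)
    (θ : Vec m) (s : S) (a : Vec d) : Vec d →L[ℝ] ℝ :=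
  fderiv ℝ (B s) a - α • (P.mixture θ s a)⁻¹ • fderiv ℝ (P.mixture θ s) a

/-- The score `∇_θ log π_θ(a | s)`. -/
noncomputable def score (P : ReparamMixture S m N d) (θ : Vec m) (s : S) (a : Vec d) :
    Vec m →L[ℝ] ℝ :=
  (P.mixture θ s a)⁻¹ • fderiv ℝ (fun θ' => P.mixture θ' s a) θ

/-- The derivative of `θ' ↦ regularize θ s (f_θ'(ε; s, k))` at `θ`: only the action, not the
logarithm, depends on `θ'`. -/
noncomputable def pathDeriv (P : ReparamMixture S m N d) (B : S → Vec d → ℝ) (α : ℝ) (θ : Vec m)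
    (s : S) (k : Fin N) (ε : Vec d) : Vec m →L[ℝ] ℝ :=
  (P.regularizeDeriv B α θ s (P.f θ s k ε)).comp (fderiv ℝ (fun θ' => P.f θ' s k ε) θ)

/-- The random vector of the policy gradient theorem, as a linear functional. -/
noncomputable def gradForm (P : ReparamMixture S m N d) (B : S → Vec d → ℝ) (α : ℝ) (θ : Vec m)
    (s : S) (k : Fin N) (ε : Vec d) : Vec m →L[ℝ] ℝ :=
  P.regularize B α θ s (P.f θ s k ε) •
    (P.weight θ s k)⁻¹ • fderiv ℝ (fun θ' => P.weight θ' s k) θ + P.pathDeriv B α θ s k ε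

end Definitions

section Domination

variable {S : Type*} [TopologicalSpace S] [CompactSpace S] {m N d : ℕ}
  {P : ReparamMixture S m N d} {A : Set (Vec d)} {B : S → Vec d → ℝ} {U : Set (Vec m)}
  (hP : P.IsC1PolicyOn A) (hU : IsLocalDomain P.Θ U)
include hP hU

lemma noiseDominated_comp_f {F : Type*} [NormedAddCommGroup F] {g : Vec m → S → Vec d → F}
    (hg : ContinuousOn (fun x : Vec m × S × Vec d => g x.1 x.2.1 x.2.2) {x | x.1 ∈ P.Θ}) :
    P.NoiseDominated U 1 fun θ s k ε => g θ s (P.f θ s k ε) :=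
  .of_continuousOn hU hP.isCompact_E fun k =>
    hg.comp (f := fun x : Vec m × S × Vec d => (x.1, x.2.1, P.f x.1 x.2.1 k x.2.2))
      (continuousOn_fst.prodMk ((continuous_fst.comp continuous_snd).continuousOn.prodMk
        (hP.f k).continuousOn)) fun _ hx => hx

lemma noiseDominated_inv_weight :
    P.NoiseDominated U 1 fun θ s k (_ : Vec d) => (P.weight θ s k)⁻¹ :=
  .of_continuousOn hU hP.isCompact_E fun k => ((hP.continuousOn_weight k).comp
    (f := fun x : Vec m × S × Vec d => (x.1, x.2.1)) (by fun_prop) fun _ hx => hx).inv₀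
    fun x hx => (hP.weight_pos x.1 hx x.2.1 k).ne'

lemma noiseDominated_fderiv_weight :
    P.NoiseDominated U 1 fun θ s k (_ : Vec d) => fderiv ℝ (fun θ' => P.weight θ' s k) θ :=
  .of_continuousOn hU hP.isCompact_E fun k => (hP.continuousOn_fderiv_weight k).comp
    (f := fun x : Vec m × S × Vec d => (x.1, x.2.1)) (by fun_prop) fun _ hx => hx

lemma noiseDominated_inv_mixture :
    P.NoiseDominated U P.noiseBound fun θ s k ε => (P.mixture θ s (P.f θ s k ε))⁻¹ := by
  have h_det : P.NoiseDominated U 1 fun θ s k ε => (fderiv ℝ (P.f θ s k) ε).det :=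
    .of_continuousOn hU hP.isCompact_E fun k =>
      ContinuousLinearMap.continuous_det.comp_continuousOn (hP.f k).continuousOn_fderiv_var
  exact noiseDominated_inv_noise.of_norm_le_mul
    ((noiseDominated_inv_weight hP hU).of_norm_le_mul h_det fun _ _ _ _ _ _ => (norm_mul _ _).le)
    fun θ hθ s k ε hε => hε.norm_inv_mixture_le hP.toIsPolicyOn (hU.subset hθ) s k

lemma noiseDominated_score :
    P.NoiseDominated U P.noiseBound fun θ s k ε => P.score θ s (P.f θ s k ε) :=
  (noiseDominated_inv_mixture hP hU).of_norm_le_mul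
    (noiseDominated_comp_f hP hU (g := fun θ s a => fderiv ℝ (fun θ' => P.mixture θ' s a) θ)
      hP.contC1_mixture.continuousOn_fderiv_param)
    fun _ _ _ _ _ _ => (norm_smul _ _).le

lemma noiseDominated_log_mixture :
    P.NoiseDominated U P.noiseBound fun θ s k ε => Real.log (P.mixture θ s (P.f θ s k ε)) := by
  obtain ⟨C, hC⟩ := (noiseDominated_comp_f hP hU hP.contC1_mixture.continuousOn).noiseBound
  obtain ⟨D, hD⟩ := noiseDominated_inv_mixture hP hU
  refine ⟨C + D, fun θ hθ s k ε hε => ?_⟩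
  rw [add_mul]
  exact (abs_log_le_add_inv (hε.mixture_pos hP.toIsPolicyOn (hU.subset hθ) s k)).trans (add_le_add
    ((le_abs_self _).trans (hC θ hθ s k ε hε)) ((le_abs_self _).trans (hD θ hθ s k ε hε)))

variable (hB : ContC1 P.Θ fun _ : Vec m => B) (α : ℝ)
include hB

lemma noiseDominated_regularize :
    P.NoiseDominated U P.noiseBound fun θ s k ε => P.regularize B α θ s (P.f θ s k ε) :=
  (noiseDominated_comp_f hP hU hB.continuousOn).noiseBound.of_norm_le_add
    ((noiseDominated_log_mixture hP hU).const_smul α) fun _ _ _ _ => norm_sub_le _ _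

lemma noiseDominated_pathDeriv : P.NoiseDominated U P.noiseBound (P.pathDeriv B α) := by
  have h_mixture : P.NoiseDominated U P.noiseBound fun θ s k ε =>
      α • (P.mixture θ s (P.f θ s k ε))⁻¹ • fderiv ℝ (P.mixture θ s) (P.f θ s k ε) :=
    ((noiseDominated_inv_mixture hP hU).of_norm_le_mul
      (noiseDominated_comp_f hP hU (g := fun θ s => fderiv ℝ (P.mixture θ s))
        hP.contC1_mixture.continuousOn_fderiv_var)
      fun _ _ _ _ _ _ => (norm_smul _ _).le).const_smul α
  have h_regularize : P.NoiseDominated U P.noiseBound fun θ s k ε =>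
      P.regularizeDeriv B α θ s (P.f θ s k ε) :=
    (noiseDominated_comp_f hP hU hB.continuousOn_fderiv_var).noiseBound.of_norm_le_add h_mixture
      fun _ _ _ _ => norm_sub_le _ _
  exact h_regularize.of_norm_le_mul
    (.of_continuousOn hU hP.isCompact_E fun k => (hP.f k).continuousOn_fderiv_param)
    fun _ _ _ _ _ _ => ContinuousLinearMap.opNorm_comp_le _ _

lemma noiseDominated_gradForm : P.NoiseDominated U P.noiseBound (P.gradForm B α) := by
  have h_weight := (noiseDominated_inv_weight hP hU).of_norm_le_mul
    (noiseDominated_fderiv_weight hP hU) fun _ _ _ _ _ _ => (norm_smul _ _).le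
  exact ((noiseDominated_regularize hP hU hB α).of_norm_le_mul h_weight
    fun _ _ _ _ _ _ => (norm_smul _ _).le).of_norm_le_add
    (noiseDominated_pathDeriv hP hU hB α) fun _ _ _ _ => norm_add_le _ _

end Domination

end ReparamMixture

namespace ReparamMixture

section Measurability

variable {S : Type*} [TopologicalSpace S] [MeasurableSpace S] [OpensMeasurableSpace S]
  {m N d : ℕ} {P : ReparamMixture S m N d} {B : S → Vec d → ℝ}

namespace Regular

variable (hreg : P.Regular) (hB : ContC1 P.Θ fun _ : Vec m => B) (α : ℝ) {θ : Vec m}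
  (hθ : θ ∈ P.Θ)
include hreg hθ

lemma measurable_mixture : Measurable fun x : S × Vec d => P.mixture θ x.1 x.2 :=
  (hreg.contC1_mixture.continuous_of_mem hθ).measurable

lemma measurable_prodMk_f (k : Fin N) :
    Measurable fun x : S × Vec d => (x.1, P.f θ x.1 k x.2) :=
  measurable_fst.prodMk ((hreg.f k).continuous_of_mem hθ).measurable

lemma stronglyMeasurable_score :
    StronglyMeasurable fun x : S × Vec d => P.score θ x.1 x.2 :=
  (hreg.measurable_mixture hθ).inv.stronglyMeasurable.smul
    (hreg.contC1_mixture.continuous_fderiv_param_of_mem hθ).stronglyMeasurable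

include hB

lemma stronglyMeasurable_regularize :
    StronglyMeasurable fun x : S × Vec d => P.regularize B α θ x.1 x.2 :=
  ((hB.continuous_of_mem hθ).measurable.sub
    ((hreg.measurable_mixture hθ).log.const_mul α)).stronglyMeasurable

lemma stronglyMeasurable_regularizeDeriv :
    StronglyMeasurable fun x : S × Vec d => P.regularizeDeriv B α θ x.1 x.2 :=
  (hB.continuous_fderiv_var_of_mem hθ).stronglyMeasurable.sub
    (((hreg.measurable_mixture hθ).inv.stronglyMeasurable.smul
      (hreg.contC1_mixture.continuous_fderiv_var_of_mem hθ).stronglyMeasurable).const_smul α)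

lemma stronglyMeasurable_pathDeriv (k : Fin N) :
    StronglyMeasurable fun x : S × Vec d => P.pathDeriv B α θ x.1 k x.2 :=
  isBoundedBilinearMap_comp.continuous.comp_stronglyMeasurable
    (((hreg.stronglyMeasurable_regularizeDeriv hB α hθ).comp_measurable
      (hreg.measurable_prodMk_f hθ k)).prodMk
      ((hreg.f k).continuous_fderiv_param_of_mem hθ).stronglyMeasurable)

lemma stronglyMeasurable_gradForm (k : Fin N) :
    StronglyMeasurable fun x : S × Vec d => P.gradForm B α θ x.1 k x.2 := by
  have h_weight : StronglyMeasurable fun x : S × Vec d =>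
      (P.weight θ x.1 k)⁻¹ • fderiv ℝ (fun θ' => P.weight θ' x.1 k) θ :=
    ((hreg.continuous_weight hθ k).measurable.inv.stronglyMeasurable.smul
      (hreg.continuous_fderiv_weight hθ k).stronglyMeasurable).comp_measurable measurable_fst
  exact (((hreg.stronglyMeasurable_regularize hB α hθ).comp_measurable
    (hreg.measurable_prodMk_f hθ k)).smul h_weight).add
    (hreg.stronglyMeasurable_pathDeriv hB α hθ k)

end Regular

end Measurability

section Derivative

lemma IsPolicyOn.mixture_smul_score {S : Type*} {m N d : ℕ} {P : ReparamMixture S m N d}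
    {A : Set (Vec d)} (hP : P.IsPolicyOn A) {θ : Vec m} (hθ : θ ∈ P.Θ) (s : S) {a : Vec d}
    (ha : a ∈ A) :
    P.mixture θ s a • P.score θ s a = fderiv ℝ (fun θ' => P.mixture θ' s a) θ := by
  rw [score]
  rcases eq_or_ne (P.mixture θ s a) 0 with h_zero | h_ne
  · have h_min : IsLocalMin (fun θ' => P.mixture θ' s a) θ := by
      filter_upwards [hP.isOpen_Θ.mem_nhds hθ] with θ' hθ'
      exact h_zero.trans_le (hP.mixture_nonneg hθ' s ha)
    rw [h_min.fderiv_eq_zero, smul_zero, smul_zero]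
  · rw [smul_inv_smul₀ h_ne]

lemma hasFDerivAt_regularize_comp_f {S : Type*} [TopologicalSpace S] {m N d : ℕ}
    {P : ReparamMixture S m N d} {A : Set (Vec d)} {B : S → Vec d → ℝ} (hP : P.IsPolicyOn A)
    (hreg : P.Regular) (hB : ContC1 P.Θ fun _ : Vec m => B) (α : ℝ) {θ : Vec m} (hθ : θ ∈ P.Θ)
    (s : S) (k : Fin N) {ε : Vec d} (hε : P.GoodNoise ε) :
    HasFDerivAt (fun θ' => P.regularize B α θ' s (P.f θ' s k ε))
      (P.pathDeriv B α θ s k ε - α • P.score θ s (P.f θ s k ε)) θ := by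
  have h_path := (hreg.f k).hasFDerivAt_param hθ s ε
  have h_value := hB.hasFDerivAt_comp hP.isOpen_Θ hθ s h_path
  have h_log := (hreg.contC1_mixture.hasFDerivAt_comp hP.isOpen_Θ hθ s h_path).log
    (hε.mixture_pos hP hθ s k).ne'
  refine (h_value.sub (h_log.const_mul α)).congr_fderiv ?_
  ext x
  simp only [pathDeriv, regularizeDeriv, score, fderiv_fun_const, Pi.zero_apply, zero_add,
    sub_apply, add_apply, smul_apply, ContinuousLinearMap.comp_apply, smul_eq_mul]
  ring

variable {S : Type*} [TopologicalSpace S] [CompactSpace S] [SecondCountableTopology S]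
  [MeasurableSpace S] [OpensMeasurableSpace S] {m N d : ℕ} {P : ReparamMixture S m N d}
  {A : Set (Vec d)} {B : S → Vec d → ℝ} {θ : Vec m}

namespace IsC1PolicyOn

section ExpectedScore

omit [SecondCountableTopology S] [MeasurableSpace S] [OpensMeasurableSpace S]

lemma hasFDerivAt_integral_mixture (hP : P.IsC1PolicyOn A) (hθ : θ ∈ P.Θ) (s : S) :
    HasFDerivAt (fun θ' => ∫ a in A, P.mixture θ' s a)
      (∫ a in A, fderiv ℝ (fun θ' => P.mixture θ' s a) θ) θ := by
  have h_mixture := hP.contC1_mixture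
  have h_meas (θ' : Vec m) (hθ' : θ' ∈ P.Θ) : AEStronglyMeasurable (P.mixture θ' s)
      (volume.restrict A) := (hP.continuous_mixture hθ' s).aestronglyMeasurable
  obtain ⟨U, hθU, hU⟩ := exists_isLocalDomain hP.isOpen_Θ hθ
  obtain ⟨C, hC⟩ :=
    (hU.eventually_forall_norm_le hP.isCompact_A h_mixture.continuousOn_fderiv_param).exists
  have : IsFiniteMeasure (volume.restrict A) :=
    isFiniteMeasure_restrict.2 hP.isCompact_A.measure_lt_top.ne
  exact hasFDerivAt_integral_of_dominated_of_fderiv_le (hU.isOpen.mem_nhds hθU)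
    (bound := fun _ => C) (F' := fun θ' a => fderiv ℝ (fun θ' => P.mixture θ' s a) θ')
    (eventually_of_mem (hP.isOpen_Θ.mem_nhds hθ) h_meas)
    ((hP.continuous_mixture hθ s).continuousOn.integrableOn_compact hP.isCompact_A)
    ((h_mixture.continuous_fderiv_param_of_mem hθ).comp
      (Continuous.prodMk_right s)).aestronglyMeasurable
    (ae_restrict_of_forall_mem hP.isCompact_A.measurableSet fun a ha θ' hθ' => hC θ' hθ' s a ha)
    (integrable_const C)
    (ae_of_all _ fun a θ' hθ' => h_mixture.hasFDerivAt_param (hU.subset hθ') s a)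

lemma integral_fderiv_mixture (hP : P.IsC1PolicyOn A) (hθ : θ ∈ P.Θ) (s : S) :
    ∫ a in A, fderiv ℝ (fun θ' => P.mixture θ' s a) θ = 0 := by
  refine (hP.hasFDerivAt_integral_mixture hθ s).unique
    ((hasFDerivAt_const (1 : ℝ) θ).congr_of_eventuallyEq ?_)
  filter_upwards [hP.isOpen_Θ.mem_nhds hθ] with θ' hθ'
  exact hP.integral_mixture hP.toRegular hP.isCompact_A.measurableSet
    hP.isCompact_E.measurableSet hθ' s

end ExpectedScore

variable (hP : P.IsC1PolicyOn A) (hθ : θ ∈ P.Θ) (s : S)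
include hP hθ

lemma integrable_score (k : Fin N) :
    Integrable (fun ε => P.score θ s (P.f θ s k ε)) P.noiseLaw := by
  obtain ⟨U, hθU, hU⟩ := exists_isLocalDomain hP.isOpen_Θ hθ
  exact (noiseDominated_score hP hU).integrable hP hθU s k
    ((hP.stronglyMeasurable_score hθ).comp_measurable
      ((hP.measurable_prodMk_f hθ k).comp measurable_prodMk_left)).aestronglyMeasurable

lemma sum_integral_score :
    ∑ k, P.weight θ s k • ∫ ε, P.score θ s (P.f θ s k ε) ∂P.noiseLaw = 0 := by
  have h_measA := hP.isCompact_A.measurableSet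
  rw [← hP.integral_fderiv_mixture hθ s, ← hP.integral_mixture_smul hP.toRegular h_measA hθ s
    (q := P.score θ s) ((hP.stronglyMeasurable_score hθ).comp_measurable measurable_prodMk_left)
    fun k => hP.integrable_score hθ s k]
  exact setIntegral_congr_fun h_measA fun a ha => hP.mixture_smul_score hθ s ha

variable (hB : ContC1 P.Θ fun _ : Vec m => B) (α : ℝ) (k : Fin N)
include hB

lemma integrable_regularize :
    Integrable (fun ε => P.regularize B α θ s (P.f θ s k ε)) P.noiseLaw := by
  obtain ⟨U, hθU, hU⟩ := exists_isLocalDomain hP.isOpen_Θ hθ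
  exact (noiseDominated_regularize hP hU hB α).integrable hP hθU s k
    ((hP.stronglyMeasurable_regularize hB α hθ).comp_measurable
      ((hP.measurable_prodMk_f hθ k).comp measurable_prodMk_left)).aestronglyMeasurable

lemma integrable_pathDeriv : Integrable (P.pathDeriv B α θ s k) P.noiseLaw := by
  obtain ⟨U, hθU, hU⟩ := exists_isLocalDomain hP.isOpen_Θ hθ
  exact (noiseDominated_pathDeriv hP hU hB α).integrable hP hθU s k
    ((hP.stronglyMeasurable_pathDeriv hB α hθ k).comp_measurable
      measurable_prodMk_left).aestronglyMeasurable

lemma hasFDerivAt_integral_regularize :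
    HasFDerivAt (fun θ' => ∫ ε, P.regularize B α θ' s (P.f θ' s k ε) ∂P.noiseLaw)
      (∫ ε, P.pathDeriv B α θ s k ε ∂P.noiseLaw -
        α • ∫ ε, P.score θ s (P.f θ s k ε) ∂P.noiseLaw) θ := by
  obtain ⟨U, hθU, hU⟩ := exists_isLocalDomain hP.isOpen_Θ hθ
  have h_path := hP.integrable_pathDeriv hθ s hB α k
  have h_score := (hP.integrable_score hθ s k).smul α
  have h_dominated : P.NoiseDominated U P.noiseBound fun θ s k ε =>
      P.pathDeriv B α θ s k ε - α • P.score θ s (P.f θ s k ε) :=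
    (noiseDominated_pathDeriv hP hU hB α).of_norm_le_add
      ((noiseDominated_score hP hU).const_smul α) fun _ _ _ _ => norm_sub_le _ _
  rw [← integral_smul, ← integral_sub (g := fun ε => α • P.score θ s (P.f θ s k ε)) h_path h_score]
  exact h_dominated.hasFDerivAt_integral (h := fun θ s k ε => P.regularize B α θ s (P.f θ s k ε))
    hP hU.isOpen s k
    (fun θ' hθ' => hP.integrable_regularize (hU.subset hθ') s hB α k) hθU
    (h_path.sub h_score).aestronglyMeasurable fun θ' hθ' ε hε =>
      hasFDerivAt_regularize_comp_f hP.toIsPolicyOn hP.toRegular hB α (hU.subset hθ') s k hε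

lemma weight_smul_integral_gradForm :
    P.weight θ s k • ∫ ε, P.gradForm B α θ s k ε ∂P.noiseLaw =
      P.weight θ s k • ∫ ε, P.pathDeriv B α θ s k ε ∂P.noiseLaw +
        (∫ ε, P.regularize B α θ s (P.f θ s k ε) ∂P.noiseLaw) •
          fderiv ℝ (fun θ' => P.weight θ' s k) θ := by
  simp only [gradForm]
  rw [integral_add ((hP.integrable_regularize hθ s hB α k).smul_const _)
      (hP.integrable_pathDeriv hθ s hB α k), integral_smul_const, smul_add, add_comm,
    smul_comm (P.weight θ s k), smul_inv_smul₀ (hP.weight_pos θ hθ s k).ne']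

omit k in
lemma hasFDerivAt_sum_integral_regularize :
    HasFDerivAt (fun θ' => ∑ k, P.weight θ' s k *
        ∫ ε, P.regularize B α θ' s (P.f θ' s k ε) ∂P.noiseLaw)
      (∑ k, P.weight θ s k • ∫ ε, P.gradForm B α θ s k ε ∂P.noiseLaw) θ := by
  refine (HasFDerivAt.fun_sum fun k _ => (hP.hasFDerivAt_weight hθ s k).mul
    (hP.hasFDerivAt_integral_regularize hθ s hB α k)).congr_fderiv ?_
  simp_rw [hP.weight_smul_integral_gradForm hθ s hB α, smul_sub, sub_add_eq_add_sub,
    smul_comm (P.weight θ s _) α]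
  rw [Finset.sum_sub_distrib, ← Finset.smul_sum, hP.sum_integral_score hθ s, smul_zero, sub_zero]

end IsC1PolicyOn

end Derivative

end ReparamMixture

/-! ### Smoothness of the action value in the action -/

namespace BddMeasurable

variable {S : Type*} [TopologicalSpace S] [CompactSpace S] [SecondCountableTopology S]
  [MeasurableSpace S] [OpensMeasurableSpace S] {ν : Measure S} [IsFiniteMeasure ν]

lemma continuous_integral_bilinear {X G H F : Type*} [TopologicalSpace X]
    [FirstCountableTopology X] [LocallyCompactSpace X] [NormedAddCommGroup G] [NormedSpace ℝ G]
    [NormedAddCommGroup H] [NormedSpace ℝ H] [NormedAddCommGroup F] [NormedSpace ℝ F]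
    {V : S → H} (hV : BddMeasurable V) (L : G →L[ℝ] H →L[ℝ] F) {φ : X → S → G}
    (hφ : Continuous (Function.uncurry φ)) : Continuous fun x => ∫ s, L (φ x s) (V s) ∂ν := by
  refine continuous_iff_continuousAt.2 fun x₀ => ?_
  obtain ⟨W, hW, hx₀⟩ := exists_compact_mem_nhds x₀
  obtain ⟨C, hC⟩ := (hW.prod isCompact_univ).exists_bound_of_continuousOn hφ.continuousOn
  obtain ⟨hV_meas, D, hD⟩ := hV
  refine continuousAt_of_dominated (bound := fun _ => ‖L‖ * C * D)
    (Eventually.of_forall fun x => ?_) ?_ (integrable_const _) (ae_of_all _ fun s => ?_)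
  · exact (L.isBoundedBilinearMap.continuous.comp_stronglyMeasurable
      ((hφ.comp (Continuous.prodMk_right x)).stronglyMeasurable.prodMk
        hV_meas)).aestronglyMeasurable
  · filter_upwards [hx₀] with x hx
    exact ae_of_all _ fun s => L.le_of_opNorm₂_le_of_le le_rfl (hC (x, s) ⟨hx, trivial⟩) (hD s)
  · exact ((L.continuous.comp (hφ.comp (Continuous.prodMk_left s))).clm_apply
      continuous_const).continuousAt

lemma hasFDerivAt_integral_smul {E : Type*} [NormedAddCommGroup E] [NormedSpace ℝ E]
    [LocallyCompactSpace E] {V : S → ℝ} (hV : BddMeasurable V) {φ : E → S → ℝ}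
    {φ' : E → S → E →L[ℝ] ℝ} (hφ : ∀ x, Continuous (φ x))
    (hφ' : Continuous (Function.uncurry φ')) (h_diff : ∀ x s, HasFDerivAt (φ · s) (φ' x s) x)
    (x : E) : HasFDerivAt (fun x => ∫ s, φ x s • V s ∂ν) (∫ s, V s • φ' x s ∂ν) x := by
  obtain ⟨W, hW, hx⟩ := exists_compact_mem_nhds x
  obtain ⟨C, hC⟩ := (hW.prod isCompact_univ).exists_bound_of_continuousOn hφ'.continuousOn
  obtain ⟨C', hC'⟩ := isCompact_univ.exists_bound_of_continuousOn (hφ x).continuousOn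
  have h_bdd : BddMeasurable (φ x) := ⟨(hφ x).stronglyMeasurable, C', fun s => hC' s trivial⟩
  have h_meas (y : E) : AEStronglyMeasurable (fun s => φ y s • V s) ν :=
    ((hφ y).stronglyMeasurable.smul hV.1).aestronglyMeasurable
  have h_meas' : AEStronglyMeasurable (fun s => V s • φ' x s) ν :=
    (hV.1.smul (hφ'.comp (Continuous.prodMk_right x)).stronglyMeasurable).aestronglyMeasurable
  obtain ⟨D, hD⟩ := hV.2
  refine hasFDerivAt_integral_of_dominated_of_fderiv_le hx (bound := fun _ => D * C)
    (F' := fun y s => V s • φ' y s) (Eventually.of_forall h_meas)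
    ((h_bdd.integrable ν).mul_bdd hV.1.aestronglyMeasurable (ae_of_all _ hD)) h_meas'
    (ae_of_all _ fun s y hy => ?_) (integrable_const _)
    (ae_of_all _ fun s y _ => (h_diff y s).mul_const (V s))
  rw [norm_smul]
  exact mul_le_mul (hD s) (hC (y, s) ⟨hy, trivial⟩) (norm_nonneg _)
    ((norm_nonneg _).trans (hD s))

end BddMeasurable

namespace MDP

variable {S : Type*} [TopologicalSpace S] [CompactSpace S] [SecondCountableTopology S]
  [MeasurableSpace S] [OpensMeasurableSpace S] {ν : Measure S} [IsFiniteMeasure ν] {d : ℕ}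
  {M : MDP S ν d} {π : S → Vec d → ℝ}

omit [CompactSpace S] [SecondCountableTopology S] [OpensMeasurableSpace S]
  [IsFiniteMeasure ν] in
lemma Regular.continuous_fderiv_trans (hM : M.Regular) :
    Continuous (Function.uncurry fun (x : S × Vec d) (s' : S) =>
      fderiv ℝ (fun a => M.trans x.1 a s') x.2) :=
  (continuousOn_univ.1 hM.partial_trans.2).comp
    (by fun_prop : Continuous fun y : (S × Vec d) × S => ((y.1.1, y.2), y.1.2))

lemma IsPolicy.hasFDerivAt_bellmanQ (hM : M.Regular) (hπ : M.IsPolicy π) (α : ℝ) (s : S)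
    (a : Vec d) :
    HasFDerivAt (M.bellmanQ α π s) (fderiv ℝ (M.reward s) a + M.discount •
      ∫ s', M.stateValue α π s' • fderiv ℝ (fun a => M.trans s a s') a ∂ν) a := by
  have h_trans : HasFDerivAt (fun a => ∫ s', M.trans s a s' • M.stateValue α π s' ∂ν)
      (∫ s', M.stateValue α π s' • fderiv ℝ (fun a => M.trans s a s') a ∂ν) a :=
    (hπ.bddMeasurable_stateValue hM α).hasFDerivAt_integral_smul
      (φ' := fun a s' => fderiv ℝ (fun a => M.trans s a s') a)
      (fun a => hM.continuous_trans.comp (by fun_prop : Continuous fun s' => (s, a, s')))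
      (hM.continuous_fderiv_trans.comp
        (by fun_prop : Continuous fun x : Vec d × S => ((s, x.1), x.2)))
      (fun a s' => (hM.partial_trans.1 ((s, s'), a) trivial).hasFDerivAt) a
  exact (hM.partial_reward.1 (s, a) trivial).hasFDerivAt.add (h_trans.const_mul M.discount)

lemma IsPolicy.contC1_bellmanQ (hM : M.Regular) (hπ : M.IsPolicy π) (α : ℝ) {m : ℕ}
    (Θ : Set (Vec m)) [LocallyCompactSpace S] :
    ContC1 Θ fun _ : Vec m => M.bellmanQ α π := by
  have h_value := hπ.bddMeasurable_stateValue hM α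
  have h_deriv := hπ.hasFDerivAt_bellmanQ hM α
  have h_cont : Continuous fun x : S × Vec d => M.bellmanQ α π x.1 x.2 := by
    refine hM.continuous_reward.add (continuous_const.mul ?_)
    exact h_value.continuous_integral_bilinear (ContinuousLinearMap.lsmul ℝ ℝ)
      (φ := fun (x : S × Vec d) s' => M.trans x.1 x.2 s') (hM.continuous_trans.comp
        (by fun_prop : Continuous fun y : (S × Vec d) × S => (y.1.1, y.1.2, y.2)))
  have h_deriv_cont : Continuous fun x : S × Vec d => fderiv ℝ (M.bellmanQ α π x.1) x.2 := by
    simp_rw [fun s a => (h_deriv s a).fderiv]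
    exact (continuousOn_univ.1 hM.partial_reward.2).add
      ((h_value.continuous_integral_bilinear
        (ContinuousLinearMap.lsmul ℝ ℝ (E := Vec d →L[ℝ] ℝ)).flip
        hM.continuous_fderiv_trans).const_smul M.discount)
  refine ⟨(h_cont.comp continuous_snd).continuousOn, ⟨fun z _ => differentiableAt_const _, ?_⟩,
    ⟨fun z _ => (h_deriv z.1.2 z.2).differentiableAt, ?_⟩⟩
  · simp only [fderiv_fun_const]
    exact continuousOn_const
  · exact (h_deriv_cont.comp (by fun_prop : Continuous fun x : (Vec m × S) × Vec d =>
      (x.1.2, x.2))).continuousOn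

end MDP

/-! ### The derivative of the objective -/

namespace ReparamMixture

/-- The expectation of `gradForm` over the component and the noise, in the state `s`. -/
noncomputable def stateGrad {S : Type*} {m N d : ℕ} (P : ReparamMixture S m N d)
    (B : S → Vec d → ℝ) (α : ℝ) (θ : Vec m) (s : S) : Vec m →L[ℝ] ℝ :=
  ∑ k, P.weight θ s k • ∫ ε, P.gradForm B α θ s k ε ∂P.noiseLaw

namespace IsC1PolicyOn

variable {S : Type*} [TopologicalSpace S] [CompactSpace S] {m N d : ℕ}
  {P : ReparamMixture S m N d} {A : Set (Vec d)} {θ : Vec m}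

omit [CompactSpace S] in
lemma continuous_mixture_mul_log (hP : P.IsC1PolicyOn A) (hθ : θ ∈ P.Θ) :
    Continuous fun x : S × Vec d => P.mixture θ x.1 x.2 * Real.log (P.mixture θ x.1 x.2) :=
  Real.continuous_mul_log.comp (hP.contC1_mixture.continuous_of_mem hθ)

lemma tendstoUniformly_mixture (hP : P.IsC1PolicyOn A) (hθ : θ ∈ P.Θ) :
    TendstoUniformly (fun θ' (x : S × A) => P.mixture θ' x.1 x.2)
      (fun x => P.mixture θ x.1 x.2) (𝓝 θ) := by
  intro u hu
  obtain ⟨v, hv, h_close⟩ := (isCompact_univ.prod hP.isCompact_A).mem_uniformity_of_prod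
    (s := P.Θ) (f := fun θ' (x : S × Vec d) => P.mixture θ' x.1 x.2)
    (hP.contC1_mixture.continuousOn.mono fun _ hx => hx.1) hθ (symm_le_uniformity hu)
  rw [hP.isOpen_Θ.nhdsWithin_eq hθ] at hv
  filter_upwards [hv] with θ' hθ' x
  exact h_close θ' hθ' (x.1, x.2) ⟨trivial, x.2.2⟩

variable [SecondCountableTopology S]

lemma exists_norm_stateGrad_le {U : Set (Vec m)} {B : S → Vec d → ℝ} (hP : P.IsC1PolicyOn A)
    (hU : IsLocalDomain P.Θ U) (hB : ContC1 P.Θ fun _ : Vec m => B) (α : ℝ) :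
    ∃ C, ∀ θ ∈ U, ∀ s, ‖P.stateGrad B α θ s‖ ≤ C := by
  obtain ⟨C, hC⟩ := (noiseDominated_gradForm hP hU hB α).exists_norm_integral_le hP
  refine ⟨C, fun θ hθ s => ?_⟩
  have h_pos (k : Fin N) : 0 ≤ P.weight θ s k := (hP.weight_pos θ (hU.subset hθ) s k).le
  calc ‖P.stateGrad B α θ s‖ ≤ ∑ k, P.weight θ s k * C := norm_sum_le_of_le _ fun k _ => by
        rw [norm_smul, Real.norm_of_nonneg (h_pos k)]
        exact mul_le_mul_of_nonneg_left (hC θ hθ s k) (h_pos k)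
    _ = C := by rw [← Finset.sum_mul, hP.sum_weight θ (hU.subset hθ) s, one_mul]

variable [MeasurableSpace S] [OpensMeasurableSpace S]

lemma bddMeasurable_stateGrad {B : S → Vec d → ℝ} (hP : P.IsC1PolicyOn A) (hθ : θ ∈ P.Θ)
    (hB : ContC1 P.Θ fun _ : Vec m => B) (α : ℝ) : BddMeasurable (P.stateGrad B α θ) := by
  obtain ⟨U, hθU, hU⟩ := exists_isLocalDomain hP.isOpen_Θ hθ
  obtain ⟨C, hC⟩ := hP.exists_norm_stateGrad_le hU hB α
  have := hP.isProbabilityMeasure_noiseLaw hP.isCompact_E.measurableSet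
  refine ⟨Finset.stronglyMeasurable_fun_sum _ fun k _ => ?_, C, hC θ hθU⟩
  exact (hP.continuous_weight hθ k).stronglyMeasurable.smul
    (hP.stronglyMeasurable_gradForm hB α hθ k).integral_prod_right'

variable {ν : Measure S} {M : MDP S ν d} (hP : P.IsC1PolicyOn M.A) (hθ : θ ∈ P.Θ)
include hP hθ

omit [SecondCountableTopology S] in
lemma isPolicy_mixture : M.IsPolicy (P.mixture θ) where
  measurable := hP.measurable_mixture hθ
  nonneg s _ ha := hP.mixture_nonneg hθ s ha
  integral_eq_one s := hP.integral_mixture hP.toRegular hP.isCompact_A.measurableSet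
    hP.isCompact_E.measurableSet hθ s
  entropy := by
    have h_cont := hP.continuous_mixture_mul_log hθ
    have : IsFiniteMeasure (volume.restrict M.A) :=
      isFiniteMeasure_restrict.2 M.isCompact_A.measure_lt_top.ne
    obtain ⟨C, hC⟩ := (isCompact_univ.prod M.isCompact_A).exists_bound_of_continuousOn
      h_cont.continuousOn
    refine ⟨(h_cont.stronglyMeasurable.integral_prod_right' (ν := volume.restrict M.A)).neg,
      C * (volume.restrict M.A).real Set.univ, fun s => ?_⟩
    rw [MDP.entropy, norm_neg]
    exact norm_integral_le_of_norm_le_const (ae_restrict_of_forall_mem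
      M.isCompact_A.measurableSet fun a ha => hC (s, a) ⟨trivial, ha⟩)

lemma integral_policyKernel_add_entropy {B : S → Vec d → ℝ} (hB : ContC1 P.Θ fun _ : Vec m => B)
    (α : ℝ) (s : S) :
    ∫ a : M.A, B s a ∂M.policyKernel (P.mixture θ) s + α * M.entropy (P.mixture θ) s =
      ∑ k, P.weight θ s k * ∫ ε, P.regularize B α θ s (P.f θ s k ε) ∂P.noiseLaw := by
  have h_sum := hP.integral_mixture_smul hP.toRegular hP.isCompact_A.measurableSet hθ s
    (q := P.regularize B α θ s)
    ((hP.stronglyMeasurable_regularize hB α hθ).comp_measurable measurable_prodMk_left)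
    fun k => hP.integrable_regularize hθ s hB α k
  have h_value : IntegrableOn (fun a => P.mixture θ s a • B s a) M.A :=
    ((hP.continuous_mixture hθ s).mul ((hB.continuous_of_mem hθ).comp
      (Continuous.prodMk_right s))).continuousOn.integrableOn_compact hP.isCompact_A
  have h_entropy : IntegrableOn
      (fun a => α * (P.mixture θ s a * Real.log (P.mixture θ s a))) M.A :=
    (((hP.continuous_mixture_mul_log hθ).comp
      (Continuous.prodMk_right s)).continuousOn.integrableOn_compact hP.isCompact_A).const_mul α
  simp only [smul_eq_mul] at h_sum
  rw [← h_sum, (hP.isPolicy_mixture hθ).integral_policyKernel (fun a => B s a) s,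
    M.integral_actionVolume fun a => P.mixture θ s a • B s a, MDP.entropy, mul_neg,
    ← sub_eq_add_neg, ← integral_const_mul, ← integral_sub h_value h_entropy]
  congr 1 with a
  rw [regularize, smul_eq_mul]
  ring

variable [LocallyCompactSpace S] [IsFiniteMeasure ν] (hM : M.Regular) (α : ℝ)
include hM

lemma hasFDerivAt_lookahead {π : S → Vec d → ℝ} (hπ : M.IsPolicy π) (s : S) :
    HasFDerivAt (fun θ' => M.lookahead α π (P.mixture θ') s)
      (P.stateGrad (M.bellmanQ α π) α θ s) θ := by
  have hB := hπ.contC1_bellmanQ hM α P.Θ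
  refine (hP.hasFDerivAt_sum_integral_regularize hθ s hB α).congr_of_eventuallyEq ?_
  filter_upwards [hP.isOpen_Θ.mem_nhds hθ] with θ' hθ'
    using hP.integral_policyKernel_add_entropy hθ' hB α s

lemma hasFDerivAt_objective :
    HasFDerivAt (fun θ' => M.objective α (P.mixture θ'))
      (∫ s, P.stateGrad (M.bellmanQ α (P.mixture θ)) α θ s ∂M.occupancy (P.mixture θ)) θ := by
  have := hM.isMarkovKernel_transKernel
  have hπ := hP.isPolicy_mixture hθ
  have hB := hπ.contC1_bellmanQ hM α P.Θ
  have hG := hP.bddMeasurable_stateGrad hθ hB α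
  obtain ⟨U, hθU, hU⟩ := exists_isLocalDomain hP.isOpen_Θ hθ
  have h_nhds := hU.isOpen.mem_nhds hθU
  have h_policy : ∀ᶠ θ' in 𝓝 θ, M.IsPolicy (P.mixture θ') :=
    eventually_of_mem (hP.isOpen_Θ.mem_nhds hθ) fun θ' hθ' => hP.isPolicy_mixture hθ'
  obtain ⟨L, hL⟩ := hP.exists_norm_stateGrad_le hU hB α
  obtain ⟨C, hC⟩ := hM.exists_occupancy_le
  have h_lip (θ' : Vec m) (hθ' : θ' ∈ U) (s : S) :
      ‖M.lookahead α (P.mixture θ) (P.mixture θ') s -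
        M.lookahead α (P.mixture θ) (P.mixture θ) s‖ ≤ L * ‖θ' - θ‖ :=
    hU.convex.norm_image_sub_le_of_norm_hasFDerivWithin_le
      (fun x hx => (hP.hasFDerivAt_lookahead (hU.subset hx) hM α hπ s).hasFDerivWithinAt)
      (fun x hx => hL x hx s) hθU hθ'
  have h_gain := hasFDerivAt_integral_sub_of_le_smul (h_policy.mono fun θ' => hC _)
    (h_policy.mono fun θ' hθ' => (hπ.bddMeasurable_lookahead hM α hθ').integrable ν)
    (hG.integrable ν) (integrable_const L) (eventually_of_mem h_nhds h_lip)
    (hP.hasFDerivAt_lookahead hθ hM α hπ)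
    (hπ.tendsto_integral_occupancy h_policy (hP.tendstoUniformly_mixture hθ) hG)
  refine (h_gain.add_const (M.objective α (P.mixture θ))).congr_of_eventuallyEq ?_
  filter_upwards [h_policy] with θ' hθ'
  rw [← hπ.objective_sub_eq_integral_lookahead_sub hM α hθ', sub_add_cancel]

end IsC1PolicyOn

end ReparamMixture

/-! ### Sampling the state, the component and the noise -/

lemma measurable_of_forall_measurable_index {X ι Y Z : Type*} [MeasurableSpace X] [Countable ι]
    [MeasurableSpace ι] [MeasurableSingletonClass ι] [MeasurableSpace Y] [MeasurableSpace Z]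
    {h : X → ι → Y → Z} (hh : ∀ i, Measurable fun x : X × Y => h x.1 i x.2) :
    Measurable fun x : X × ι × Y => h x.1 x.2.1 x.2.2 := by
  have h_swap : Measurable fun y : ι × X × Y => h y.2.1 y.1 y.2.2 :=
    measurable_from_prod_countable_right hh
  exact h_swap.comp (by fun_prop : Measurable fun x : X × ι × Y => (x.2.1, x.1, x.2.2))

namespace ReparamMixture.IsC1PolicyOn

section Measurability

variable {S : Type*} [TopologicalSpace S] [MeasurableSpace S] [OpensMeasurableSpace S]
  {m N d : ℕ} {P : ReparamMixture S m N d} {A : Set (Vec d)} {θ : Vec m}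
  (hP : P.IsC1PolicyOn A) (hθ : θ ∈ P.Θ)
include hP hθ

lemma measurable_weight : Measurable fun x : S × Fin N => P.weight θ x.1 x.2 :=
  measurable_from_prod_countable_left fun k => (hP.continuous_weight hθ k).measurable

lemma isMarkovKernel_weightKernel : IsMarkovKernel (P.weightKernel θ) :=
  isMarkovKernel_const_withDensity_ofReal (hP.measurable_weight hθ)
    (fun s k => (hP.weight_pos θ hθ s k).le) fun s => by rw [integral_count, hP.sum_weight θ hθ s]

lemma integral_weightKernel {F : Type*} [NormedAddCommGroup F] [NormedSpace ℝ F] [CompleteSpace F]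
    (h : Fin N → F) (s : S) : ∫ k, h k ∂P.weightKernel θ s = ∑ k, P.weight θ s k • h k := by
  rw [weightKernel, integral_const_withDensity_ofReal (hP.measurable_weight hθ)
    (fun s k => (hP.weight_pos θ hθ s k).le), integral_count]

lemma measurable_f : Measurable fun x : S × Fin N × Vec d => P.f θ x.1 x.2.1 x.2.2 :=
  measurable_of_forall_measurable_index fun k => (hP.measurable_prodMk_f hθ k).snd

end Measurability

section Sampling

variable {S : Type*} [TopologicalSpace S] [CompactSpace S] [SecondCountableTopology S]
  [MeasurableSpace S] [OpensMeasurableSpace S] {ν : Measure S} [IsFiniteMeasure ν] {m N d : ℕ}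
  {M : MDP S ν d} {P : ReparamMixture S m N d} {θ : Vec m} (hP : P.IsC1PolicyOn M.A)
  (hθ : θ ∈ P.Θ) (hM : M.Regular)
include hP hθ hM

lemma isFiniteMeasure_occupancy : IsFiniteMeasure (M.occupancy (P.mixture θ)) := by
  have := hM.isMarkovKernel_transKernel
  have := (hP.isPolicy_mixture hθ).isMarkovKernel_policyKernel
  infer_instance

lemma map_sampling_noise : (P.sampling M θ).map (fun x => x.2.2) =
    M.occupancy (P.mixture θ) Set.univ • P.noiseLaw := by
  have := hP.isProbabilityMeasure_noiseLaw hP.isCompact_E.measurableSet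
  have := hP.isMarkovKernel_weightKernel hθ
  have := hP.isFiniteMeasure_occupancy hθ hM
  calc (P.sampling M θ).map (fun x => x.2.2) = (P.sampling M θ).snd.snd :=
        (Measure.map_map measurable_snd measurable_snd).symm
    _ = (Kernel.const S P.noiseLaw) ∘ₘ M.occupancy (P.mixture θ) := by
        rw [sampling, Measure.snd_compProd, Measure.snd, Measure.map_comp _ _ measurable_snd,
          ← Kernel.snd_eq, Kernel.snd_prod]
    _ = _ := Measure.const_comp

lemma ae_sampling_goodNoise : ∀ᵐ x ∂P.sampling M θ, P.GoodNoise x.2.2 := by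
  refine ae_of_ae_map (f := fun x : S × Fin N × Vec d => x.2.2) (by fun_prop) ?_
  rw [hP.map_sampling_noise hθ hM]
  exact Measure.ae_smul_measure
    (hP.ae_goodNoise hP.toRegular hP.isCompact_E.measurableSet) _

lemma ae_mem_and_mixture_pos : ∀ᵐ x ∂P.sampling M θ,
    P.f θ x.1 x.2.1 x.2.2 ∈ M.A ∧ 0 < P.mixture θ x.1 (P.f θ x.1 x.2.1 x.2.2) := by
  filter_upwards [hP.ae_sampling_goodNoise hθ hM] with x hx
  exact ⟨hP.mapsTo θ hθ x.1 x.2.1 hx.mem, hx.mixture_pos hP.toIsPolicyOn hθ x.1 x.2.1⟩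

lemma map_sampling_f_absolutelyContinuous :
    (P.sampling M θ).map (fun x => P.f θ x.1 x.2.1 x.2.2) ≪ volume.restrict M.A := by
  have := hP.isProbabilityMeasure_noiseLaw hP.isCompact_E.measurableSet
  have := hP.isMarkovKernel_weightKernel hθ
  have := hP.isFiniteMeasure_occupancy hθ hM
  refine Measure.AbsolutelyContinuous.mk fun T hT h_null => ?_
  have h_pre := hP.measurable_f hθ hT
  have h_component (s : S) (k : Fin N) : P.noiseLaw (P.f θ s k ⁻¹' T) = 0 := by
    rw [← Measure.map_apply (hP.continuous_f hθ s k).measurable hT, hP.map_noise θ hθ s k]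
    exact withDensity_absolutelyContinuous _ _ h_null
  rw [Measure.map_apply (hP.measurable_f hθ) hT, sampling, Measure.compProd_apply h_pre,
    lintegral_eq_zero_of_ae_eq_zero (ae_of_all _ fun s => ?_)]
  rw [Kernel.prod_apply, Kernel.const_apply]
  exact Measure.measure_prod_null_of_ae_null (measurable_prodMk_left h_pre)
    (ae_of_all _ (h_component s))

variable {B : S → Vec d → ℝ} (hB : ContC1 P.Θ fun _ : Vec m => B) (α : ℝ)
include hB

lemma integrable_gradForm :
    Integrable (fun x => P.gradForm B α θ x.1 x.2.1 x.2.2) (P.sampling M θ) := by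
  have := hP.isFiniteMeasure_occupancy hθ hM
  obtain ⟨U, hθU, hU⟩ := exists_isLocalDomain hP.isOpen_Θ hθ
  obtain ⟨C, hC⟩ := noiseDominated_gradForm hP hU hB α
  have h_bound : Integrable (fun x => P.noiseBound x.2.2) (P.sampling M θ) := by
    have h_map := (hP.integrable_noiseBound hP.isCompact_E).smul_measure
      (measure_ne_top (M.occupancy (P.mixture θ)) Set.univ)
    rw [← hP.map_sampling_noise hθ hM] at h_map
    exact h_map.comp_measurable (by fun_prop)
  refine (h_bound.const_mul C).mono' (measurable_of_forall_measurable_index fun k =>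
    (hP.stronglyMeasurable_gradForm hB α hθ k).measurable).aestronglyMeasurable ?_
  filter_upwards [hP.ae_sampling_goodNoise hθ hM] with x hx using hC θ hθU x.1 x.2.1 x.2.2 hx

lemma integral_gradForm : ∫ x, P.gradForm B α θ x.1 x.2.1 x.2.2 ∂P.sampling M θ =
    ∫ s, P.stateGrad B α θ s ∂M.occupancy (P.mixture θ) := by
  have := hP.isProbabilityMeasure_noiseLaw hP.isCompact_E.measurableSet
  have := hP.isMarkovKernel_weightKernel hθ
  have := hP.isFiniteMeasure_occupancy hθ hM
  have h_int := hP.integrable_gradForm hθ hM hB α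
  rw [sampling] at h_int ⊢
  rw [Measure.integral_compProd h_int]
  refine integral_congr_ae ?_
  filter_upwards [((Measure.integrable_compProd_iff h_int.1).1 h_int).1] with s hs
  rw [Kernel.prod_apply, Kernel.const_apply] at hs ⊢
  rw [integral_prod _ hs, hP.integral_weightKernel hθ, stateGrad]

end Sampling

/-! ### The half-reparameterization gradient -/

section HalfReparam

variable {S : Type*} [TopologicalSpace S] [CompactSpace S] [SecondCountableTopology S]
  [MeasurableSpace S] [OpensMeasurableSpace S] {ν : Measure S} [IsFiniteMeasure ν] {m N d : ℕ}
  {M : MDP S ν d} {P : ReparamMixture S m N d} {θ : Vec m}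
  (hP : P.IsC1PolicyOn M.A) (hθ : θ ∈ P.Θ) (hM : M.Regular) (α : ℝ)
include hP hθ hM

lemma regQ_eq_regularize (s : S) {a : Vec d} (ha : a ∈ M.A) :
    P.regQ M α θ s a = P.regularize (M.bellmanQ α (P.mixture θ)) α θ s a := by
  rw [regQ, (hP.isPolicy_mixture hθ).softQ_eq_bellmanQ hM α s ha, regularize]

variable [LocallyCompactSpace S]

lemma hasFDerivWithinAt_regQ (s : S) {a : Vec d} (ha : a ∈ M.A) (h_pos : 0 < P.mixture θ s a) :
    HasFDerivWithinAt (P.regQ M α θ s)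
      (P.regularizeDeriv (M.bellmanQ α (P.mixture θ)) α θ s a) M.A a := by
  have hB := (hP.isPolicy_mixture hθ).contC1_bellmanQ hM α P.Θ
  have h_log := ((hP.contC1_mixture.hasFDerivAt_var hθ s a).log h_pos.ne').const_mul α
  exact ((hB.hasFDerivAt_var hθ s a).sub h_log).hasFDerivWithinAt.congr
    (fun b hb => hP.regQ_eq_regularize hθ hM α s hb) (hP.regQ_eq_regularize hθ hM α s ha)

lemma toDual_halfReparam {s : S} {k : Fin N} {ε : Vec d} (h_mem : P.f θ s k ε ∈ M.A)
    (h_pos : 0 < P.mixture θ s (P.f θ s k ε))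
    (h_unique : ∀ (h : Vec d → ℝ) (D D' : Vec d →L[ℝ] ℝ),
      HasFDerivWithinAt h D M.A (P.f θ s k ε) → HasFDerivWithinAt h D' M.A (P.f θ s k ε) →
        D = D') :
    InnerProductSpace.toDual ℝ (Vec m) (P.halfReparam M α θ (s, k, ε)) =
      P.gradForm (M.bellmanQ α (P.mixture θ)) α θ s k ε := by
  have h_deriv := hP.hasFDerivWithinAt_regQ hθ hM α s h_mem h_pos
  have h_fderivWithin : fderivWithin ℝ (P.regQ M α θ s) M.A (P.f θ s k ε) =
      P.regularizeDeriv (M.bellmanQ α (P.mixture θ)) α θ s (P.f θ s k ε) :=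
    h_unique _ _ _ h_deriv.differentiableWithinAt.hasFDerivWithinAt h_deriv
  have h_log_weight : fderiv ℝ (fun θ' => Real.log (P.weight θ' s k)) θ =
      (P.weight θ s k)⁻¹ • fderiv ℝ (fun θ' => P.weight θ' s k) θ :=
    ((hP.hasFDerivAt_weight hθ s k).log (hP.weight_pos θ hθ s k).ne').fderiv
  ext v
  simp only [halfReparam, gradForm, pathDeriv, gradientWithin, gradient,
    hP.regQ_eq_regularize hθ hM α s h_mem, h_log_weight, h_fderivWithin,
    InnerProductSpace.toDual_apply_apply, inner_add_left, real_inner_smul_left,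
    ContinuousLinearMap.adjoint_inner_left, InnerProductSpace.toDual_symm_apply, add_apply,
    smul_apply, ContinuousLinearMap.comp_apply, smul_eq_mul]

lemma toDual_halfReparam_ae_eq :
    (fun x => InnerProductSpace.toDual ℝ (Vec m) (P.halfReparam M α θ x)) =ᵐ[P.sampling M θ]
      fun x => P.gradForm (M.bellmanQ α (P.mixture θ)) α θ x.1 x.2.1 x.2.2 := by
  have h_unique := ae_of_ae_map (hP.measurable_f hθ).aemeasurable
    ((hP.map_sampling_f_absolutelyContinuous hθ hM).ae_le
      (ae_eq_of_hasFDerivWithinAt (F := ℝ) volume M.isCompact_A.measurableSet))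
  filter_upwards [hP.ae_mem_and_mixture_pos hθ hM, h_unique] with x hx hu
  exact hP.toDual_halfReparam hθ hM α hx.1 hx.2 hu

lemma integrable_halfReparam : Integrable (P.halfReparam M α θ) (P.sampling M θ) := by
  have hB := (hP.isPolicy_mixture hθ).contC1_bellmanQ hM α P.Θ
  exact (InnerProductSpace.toDual ℝ (Vec m)).integrable_comp_iff.1 <|
    (hP.integrable_gradForm hθ hM hB α).congr (hP.toDual_halfReparam_ae_eq hθ hM α).symm

lemma hasGradientAt_objective :
    HasGradientAt (fun θ' => M.objective α (P.mixture θ'))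
      (∫ x, P.halfReparam M α θ x ∂P.sampling M θ) θ := by
  rw [hasGradientAt_iff_hasFDerivAt]
  refine (hP.hasFDerivAt_objective hθ hM α).congr_fderiv ?_
  rw [← hP.integral_gradForm hθ hM ((hP.isPolicy_mixture hθ).contC1_bellmanQ hM α P.Θ),
    ← integral_congr_ae (hP.toDual_halfReparam_ae_eq hθ hM α)]
  exact ContinuousLinearMap.integral_comp_commSL RCLike.conj_smul
    (InnerProductSpace.toDual ℝ (Vec m)).toContinuousLinearEquiv.toContinuousLinearMap
    (hP.integrable_halfReparam hθ hM α)

end HalfReparam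

end ReparamMixture.IsC1PolicyOn

lemma MDP.nonempty_state {S : Type*} [MeasurableSpace S] {ν : Measure S} {d : ℕ} (M : MDP S ν d) :
    Nonempty S := by
  by_contra h_empty
  rw [not_nonempty_iff] at h_empty
  simpa [Measure.eq_zero_of_isEmpty ν] using M.integral_init

lemma ReparamMixture.IsPolicyOn.isC1PolicyOn {S : Type*} [TopologicalSpace S] [Nonempty S]
    {m N d : ℕ} {P : ReparamMixture S m N d} {A : Set (Vec d)} (hP : P.IsPolicyOn A)
    (hreg : P.Regular) (hA : IsCompact A) {θ : Vec m} (hθ : θ ∈ P.Θ) : P.IsC1PolicyOn A := by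
  obtain ⟨s⟩ := ‹Nonempty S›
  obtain ⟨k⟩ : Nonempty (Fin N) := by
    by_contra h_empty
    rw [not_nonempty_iff] at h_empty
    simpa using hP.sum_weight θ hθ s
  exact ⟨hP, hreg, hA, hP.isCompact_E hreg hA hθ s k⟩

theorem mainTheorem3 {S : Type*} [MetricSpace S] [CompactSpace S] [MeasurableSpace S]
    [BorelSpace S] (ν : Measure S) [IsFiniteMeasure ν] {m N d : ℕ} (M : MDP S ν d)
    (P : ReparamMixture S m N d) (α : ℝ) (hM : M.Regular) (hP : P.IsPolicyOn M.A)
    (hreg : P.Regular) (θ : Vec m) (hθ : θ ∈ P.Θ) :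
    (∀ᵐ x ∂(P.sampling M θ),
      P.f θ x.1 x.2.1 x.2.2 ∈ M.A ∧ 0 < P.mixture θ x.1 (P.f θ x.1 x.2.1 x.2.2) ∧
        DifferentiableWithinAt ℝ (P.regQ M α θ x.1) M.A (P.f θ x.1 x.2.1 x.2.2)) ∧
      Integrable (P.halfReparam M α θ) (P.sampling M θ) ∧
      HasGradientAt (fun θ' => M.objective α (P.mixture θ'))
        (∫ x, P.halfReparam M α θ x ∂(P.sampling M θ)) θ := by
  have := M.nonempty_state
  have hC1 := hP.isC1PolicyOn hreg M.isCompact_A hθ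
  refine ⟨?_, hC1.integrable_halfReparam hθ hM α, hC1.hasGradientAt_objective hθ hM α⟩
  filter_upwards [hC1.ae_mem_and_mixture_pos hθ hM] with x ⟨h_mem, h_pos⟩
  exact ⟨h_mem, h_pos, (hC1.hasFDerivWithinAt_regQ hθ hM α x.1 h_mem h_pos).differentiableWithinAt⟩
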